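/- **Setting.** Let $(E,d)$ be a complete geodesic metric space (any $\rho,\pi\in E$ are joined by a curve $(\gamma(t))_{t\in[0,1]}$ with $d(\gamma(s),\gamma(t))=|t-s|\,d(\rho,\pi)$), and let $\mathcal E:E\to(-\infty,+\infty]$ be lower semi-continuous with $\mathcal D(\mathcal E)=\{\mathcal E<\infty\}\neq\emptyset$. Let $E$ carry a second topology, the *weak topology*, weaker than that of $d$, such that $d$ is weakly lower semi-continuous on $E\times E$, $\mathcal E$ is weakly lower semi-continuous on metric balls, and all sets $\{\pi: d(\rho,\pi)\le c,\ \mathcal E(\pi)\le d'\}$ ($\rho\in E$, $c,d'\in\mathbb R$) are weakly compact. Let $\kappa\in\mathbb R$, $\hat\kappa=0\wedge\kappa$, and let $\mathcal E$ admit an $EVI_\kappa$ gradient flow on $E$: continuous maps $S(t):E\to E$, $t\ge0$, with $S(0)=\mathrm{id}$, $S(t+s)=S(s)\circ S(t)$, such that for every $\mu\in E$ the curve $\mu(t):=S(t)\mu$ is continuous on $[0,\infty)$, lies in $\mathcal D(\mathcal E)$ for $t>0$ and satisfies $$\tfrac12\tfrac{\mathrm d^+}{\mathrm dt}d^2(\mu(t),\rho)\le\mathcal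 E(\rho)-\mathcal E(\mu(t))-\tfrac\kappa2 d^2(\mu(t),\rho)\qquad(\rho\in\mathcal D(\mathcal E),\ t\ge0),$$ with $\mathrm d^+/\mathrm dt$ the upper right derivative. Let $I=|\partial\mathcal E|^2$, where $|\partial\mathcal E|(\rho)=\limsup_{\pi\to\rho}(\mathcal E(\rho)-\mathcal E(\pi))^+/d(\rho,\pi)$ if $\mathcal E(\rho)<\infty$, and $I=+\infty$ otherwise. **Smoothed distance and measures.** For $\varepsilon>0$ and $r\ge 0$ let $\psi_\varepsilon(r)=\sqrt{2\varepsilon}+\frac{r-\varepsilon}{\sqrt{2\varepsilon}}-\frac{(r-\varepsilon)^2}{2(2\varepsilon)^{3/2}}$ if $r\le\varepsilon$ and $\psi_\varepsilon(r)=\sqrt{2r}$ if $r>\varepsilon$. Put $h^\varepsilon_{\pi,\mu}(t)=e^{\hat\kappa t}\psi_\varepsilon(\frac12d^2(\pi,\mu(t)))$. For integers $m,n\ge1$ let $\lambda_{m,n}=c_{m,n}\sum_{i=1}^{n^2}e^{-mi/n}\delta_{i/n}$, with $c_{m,n}$ making it a probability measure, and let $\lambda_m(\mathrm dt)=\mathbf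 1_{\{t\ge0\}}me^{-mt}\,\mathrm dt$. For a measure $\nu$ on $[0,\infty)$ and $m\geq 1$ put $$\Lambda^{\nu}_{\mu}(\pi)=\int_0^\infty e^{-mh^\varepsilon_{\pi,\mu}(t)}\nu(\mathrm dt),\qquad D^\nu_\mu(\pi)=\frac1{\Lambda^\nu_\mu(\pi)}\int_0^\infty e^{-mh^\varepsilon_{\pi,\mu}(t)}\left(\tfrac1m\vee h^\varepsilon_{\pi,\mu}(t)\right)\nu(\mathrm dt),$$ $$A^\nu_\mu(\pi)=\frac1{\Lambda^\nu_\mu(\pi)}\int_0^\infty e^{-mh^\varepsilon_{\pi,\mu}(t)}\,\psi_\varepsilon'\!\left(\tfrac12d^2(\pi,\mu(t))\right)e^{\hat\kappa t}\left[\mathcal E(\mu(t))-\mathcal E(\pi)\right]\nu(\mathrm dt).$$ **Hamiltonians.** For $\rho,\mu\in E$ with $I(\rho)+I(\mu)<\infty$, $a,b,\varepsilon>0$, $c\in\mathbb R$, $m\ge1$, define $$f^\dagger(\pi)=\tfrac a2d^2(\pi,\rho)-\tfrac bm\log\Lambda^\nu_\mu(\pi)+c,$$ $$g^\dagger(\pi)=a[\mathcal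 E(\rho)-\mathcal E(\pi)]-\tfrac{a\kappa}2d^2(\pi,\rho)+\tfrac{a^2}2d^2(\pi,\rho)+ab\,d(\pi,\rho)+\tfrac{b^2}2+bA^\nu_\mu(\pi)-\tfrac{b\hat\kappa}2D^\nu_\mu(\pi),$$ where $g^\dagger(\pi)=-\infty$ if $\mathcal E(\pi)=+\infty$. For $\gamma,\pi\in E$ with $I(\gamma)+I(\pi)<\infty$ and $a,b,\varepsilon,c,m$ as before, define $$f^\ddagger(\mu)=-\tfrac a2d^2(\gamma,\mu)+\tfrac bm\log\Lambda^\nu_\pi(\mu)+c,$$ $$g^\ddagger(\mu)=a[\mathcal E(\mu)-\mathcal E(\gamma)]+\tfrac{a\kappa}2d^2(\gamma,\mu)+\tfrac{a^2}2d^2(\gamma,\mu)-ab\,d(\gamma,\mu)-\tfrac{b^2}2-bA^\nu_\pi(\mu)+\tfrac{b\hat\kappa}2D^\nu_\pi(\mu),$$ where $g^\ddagger(\mu)=+\infty$ if $\mathcal E(\mu)=+\infty$. Let $H_{2,\dagger}$ (resp. $H_{2,\ddagger}$) be the set of all such pairs $(f^\dagger,g^\dagger)$ (resp. $(f^\ddagger,g^\ddagger)$)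 with $\nu=\lambda_{m+1,n}$, over all admissible parameters and all $n\ge1$; let $H_{3,\dagger}$, $H_{3,\ddagger}$ be the sets of all such pairs with $\nu=\lambda_{m+1}$. **Viscosity solutions.** For $\lambda>0$ and $h:E\to\mathbb R$, $u:E\to\mathbb R$ is a viscosity subsolution of $f-\lambda Af=h$ if $u$ is bounded and upper semi-continuous (for $d$) and for every $(f,g)\in A$ there is a sequence $(\pi_n)$ in $E$ with $\lim_n(u-f)(\pi_n)=\sup_E(u-f)$ and $\limsup_n\,[u(\pi_n)-\lambda g(\pi_n)-h(\pi_n)]\le0$. A function $v$ is a viscosity supersolution if it is bounded, lower semi-continuous and for every $(f,g)\in A$ there is $(\pi_n)$ with $\lim_n(v-f)(\pi_n)=\inf_E(v-f)$ and $\liminf_n\,[v(\pi_n)-\lambda g(\pi_n)-h(\pi_n)]\ge0$. **Theorem.** Let $\lambda>0$ and let $h:E\to\mathbb R$ be bounded, continuous, and continuous for the weak topology. Every weakly upper semi-continuous viscosity subsolution of $f-\lambda H_{2,\dagger}f=h$ is also a viscosity subsolution of $f-\lambda H_{3,\dagger}f=h$. Every weakly lower semi-continuous viscosity supersolution of $f-\lambda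 H_{2,\ddagger}f=h$ is also a viscosity supersolution of $f-\lambda H_{3,\ddagger}f=h$. -/

import Mathlib

open scoped BoundedContinuousFunction

noncomputable section

namespace TataruHJ

open MeasureTheory Filter Topology Set

/-! ## Metric, energy, gradient flow

Energies are functions `𝓔 : E → EReal` that never take the value `⊥`. -/

/-- Every two points are joined by a constant speed geodesic. -/
def IsGeodesicSpace (E : Type*) [MetricSpace E] : Prop :=
  ∀ ρ π : E, ∃ γ : ℝ → E, γ 0 = ρ ∧ γ 1 = π ∧
    ∀ s ∈ Icc (0 : ℝ) 1, ∀ t ∈ Icc (0 : ℝ) 1, dist (γ s) (γ t) = |t - s| * dist ρ π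

/-- Standing assumption on the metric and the energy: the metric space is complete and geodesic,
and `𝓔 : E → (-∞, +∞]` is proper and lower semi-continuous. -/
structure MetricEnergyAssumption {E : Type*} [MetricSpace E] (𝓔 : E → EReal) : Prop where
  complete : CompleteSpace E
  geodesic : IsGeodesicSpace E
  ne_bot : ∀ π, 𝓔 π ≠ ⊥
  proper : ∃ π, 𝓔 π ≠ ⊤
  lsc : LowerSemicontinuous 𝓔

/-- Standing assumption on the weak topology `τ`: it is coarser than the metric topology, the
metric is jointly weakly lower semi-continuous, `𝓔` is weakly lower semi-continuous on metric
balls, and the intersections of closed balls and sublevels of `𝓔` are weakly compact. -/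
structure WeakTopologyAssumption {E : Type*} [MetricSpace E] (𝓔 : E → EReal)
    (τ : TopologicalSpace E) : Prop where
  weaker : (UniformSpace.toTopologicalSpace : TopologicalSpace E) ≤ τ
  dist_lsc : @LowerSemicontinuous (E × E) ℝ (@instTopologicalSpaceProd E E τ τ) _
    (fun p => dist p.1 p.2)
  energy_lsc : ∀ (ρ : E) (r : ℝ), @LowerSemicontinuousOn E EReal τ _ 𝓔 (Metric.closedBall ρ r)
  compact : ∀ (ρ : E) (c d : ℝ), @IsCompact E τ {π | dist ρ π ≤ c ∧ 𝓔 π ≤ (d : EReal)}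

/-- Upper right (Dini) derivative, with values in `[-∞, +∞]`. -/
def upperRightDeriv (f : ℝ → ℝ) (t : ℝ) : EReal :=
  limsup (fun s : ℝ => (((f (t + s) - f t) / s : ℝ) : EReal)) (𝓝[>] 0)

/-- `γ`, restricted to `[0, ∞)`, solves the evolution variational inequality `EVI_κ`. -/
structure IsEVISolution {E : Type*} [MetricSpace E] (𝓔 : E → EReal) (κ : ℝ) (γ : ℝ → E) :
    Prop where
  continuousOn : ContinuousOn γ (Ici 0)
  mem_domain : ∀ t : ℝ, 0 < t → 𝓔 (γ t) ≠ ⊤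
  evi : ∀ ρ : E, 𝓔 ρ ≠ ⊤ → ∀ t : ℝ, 0 ≤ t →
    ((1 / 2 : ℝ) : EReal) * upperRightDeriv (fun s => dist (γ s) ρ ^ 2) t
      ≤ 𝓔 ρ - 𝓔 (γ t) - ((κ / 2 * dist (γ t) ρ ^ 2 : ℝ) : EReal)

/-- `S t π` (for `t ≥ 0`) is an `EVI_κ` gradient flow of `𝓔` defined on the whole of `E`. -/
structure IsEVIGradientFlow {E : Type*} [MetricSpace E] (𝓔 : E → EReal) (κ : ℝ)
    (S : ℝ → E → E) : Prop where
  continuous : ∀ t : ℝ, 0 ≤ t → Continuous (S t)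
  zero : ∀ π, S 0 π = π
  add : ∀ t s : ℝ, 0 ≤ t → 0 ≤ s → ∀ π, S (t + s) π = S s (S t π)
  evi : ∀ π, IsEVISolution 𝓔 κ (fun t => S t π)

open Classical in
/-- Local slope `|∂𝓔|`. -/
def localSlope {E : Type*} [MetricSpace E] (𝓔 : E → EReal) (ρ : E) : ENNReal :=
  if 𝓔 ρ = ⊤ then ⊤
  else limsup (fun π => (𝓔 ρ - 𝓔 π).toENNReal / edist ρ π) (𝓝[≠] ρ)

/-- The information functional `I = |∂𝓔|²`, equal to `+∞` outside the domain of `𝓔`. -/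
def information {E : Type*} [MetricSpace E] (𝓔 : E → EReal) (ρ : E) : ENNReal :=
  localSlope 𝓔 ρ ^ 2

/-! ## Viscosity sub- and supersolutions

Test functions are real valued; the images `g` may take infinite values (where `𝓔 = +∞`). -/

/-- `u` is a viscosity subsolution of `f - lam A f = h`. -/
def IsViscositySubsolution {E : Type*} [MetricSpace E] (lam : ℝ) (h : E → ℝ)
    (A : Set ((E → ℝ) × (E → EReal))) (u : E → ℝ) : Prop :=
  (∃ C : ℝ, ∀ π, |u π| ≤ C) ∧ UpperSemicontinuous u ∧
  ∀ p ∈ A, ∃ x : ℕ → E,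
    Tendsto (fun n => ((u (x n) - p.1 (x n) : ℝ) : EReal)) atTop
      (𝓝 (⨆ π, ((u π - p.1 π : ℝ) : EReal))) ∧
    limsup (fun n => (u (x n) : EReal) - (lam : EReal) * p.2 (x n) - (h (x n) : EReal)) atTop ≤ 0

/-- `v` is a viscosity supersolution of `f - lam A f = h`. -/
def IsViscositySupersolution {E : Type*} [MetricSpace E] (lam : ℝ) (h : E → ℝ)
    (A : Set ((E → ℝ) × (E → EReal))) (v : E → ℝ) : Prop :=
  (∃ C : ℝ, ∀ π, |v π| ≤ C) ∧ LowerSemicontinuous v ∧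
  ∀ p ∈ A, ∃ x : ℕ → E,
    Tendsto (fun n => ((v (x n) - p.1 (x n) : ℝ) : EReal)) atTop
      (𝓝 (⨅ π, ((v π - p.1 π : ℝ) : EReal))) ∧
    0 ≤ liminf (fun n => (v (x n) : EReal) - (lam : EReal) * p.2 (x n) - (h (x n) : EReal)) atTop

/-! ## The smoothed distance and the exponential measures -/

/-- The negative part `κ̂ = 0 ∧ κ`. -/
def kappaHat (κ : ℝ) : ℝ := min 0 κ

/-- The `C²` approximation `ψ_ε` of `r ↦ √(2r)` on `[0, ∞)`. It is only evaluated at `r ≥ 0`; the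
polynomial branch is kept for `r < 0`, so that `deriv (psi ε) 0` is the one-sided derivative. -/
def psi (ε r : ℝ) : ℝ :=
  if r ≤ ε then
    √(2 * ε) + (r - ε) / √(2 * ε) - (r - ε) ^ 2 / (2 * (2 * ε) ^ (3 / 2 : ℝ))
  else √(2 * r)

/-- The modified distance `d_ε(π, μ) = ψ_ε(d²(π, μ) / 2)`. -/
def dEps {E : Type*} [MetricSpace E] (ε : ℝ) (π μ : E) : ℝ :=
  psi ε (1 / 2 * dist π μ ^ 2)

/-- `h^ε_{π,μ}(t) = e^{κ̂ t} d_ε(π, μ(t))`, with `μ(t)` the gradient flow from `μ`. -/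
def hEps {E : Type*} [MetricSpace E] (κ : ℝ) (S : ℝ → E → E) (ε : ℝ) (π μ : E) (t : ℝ) : ℝ :=
  Real.exp (kappaHat κ * t) * dEps ε π (S t μ)

/-- The discrete approximation of the exponential distribution with parameter `m`: the
probability measure on `{i/n : 1 ≤ i ≤ n²}` with weights proportional to `e^{-m i/n}`. -/
def discreteExpMeasure (m n : ℕ) : Measure ℝ :=
  ∑ i ∈ Finset.Icc 1 (n ^ 2),
    ENNReal.ofReal ((∑ j ∈ Finset.Icc 1 (n ^ 2), Real.exp (-(m : ℝ) * ((j : ℝ) / n)))⁻¹ *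
      Real.exp (-(m : ℝ) * ((i : ℝ) / n))) • Measure.dirac ((i : ℝ) / n)

/-- `Λ(π) = ∫₀^∞ e^{-m h^ε_{π,μ}(t)} ν(dt)` for a measure `ν` on `[0, ∞)`. -/
def Lam {E : Type*} [MetricSpace E] (κ : ℝ) (S : ℝ → E → E) (ν : Measure ℝ) (ε : ℝ) (m : ℕ)
    (μ π : E) : ℝ :=
  ∫ t in Ici (0 : ℝ), Real.exp (-(m : ℝ) * hEps κ S ε π μ t) ∂ν

/-! ## The Hamiltonians

`ν` is the discrete measure for `H₂` and the exponential measure for `H₃`, both with parameter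
`m + 1`. In the integrals below, `𝓔 (μ(t))` is finite because `𝓔 μ < ∞` and `𝓔` decreases along
the flow. -/

/-- The weighted average
`Λ(π)⁻¹ ∫₀^∞ e^{-m h(t)} ψ_ε'(d²(π,μ(t))/2) e^{κ̂ t} [𝓔(μ(t)) - 𝓔(π)] ν(dt)` for `𝓔 π < ∞`. -/
def energyAverage {E : Type*} [MetricSpace E] (𝓔 : E → EReal) (κ : ℝ) (S : ℝ → E → E)
    (ν : Measure ℝ) (ε : ℝ) (m : ℕ) (μ π : E) : ℝ :=
  (Lam κ S ν ε m μ π)⁻¹ *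
    ∫ t in Ici (0 : ℝ), Real.exp (-(m : ℝ) * hEps κ S ε π μ t) *
      deriv (psi ε) (1 / 2 * dist π (S t μ) ^ 2) * Real.exp (kappaHat κ * t) *
      ((𝓔 (S t μ)).toReal - (𝓔 π).toReal) ∂ν

/-- The weighted average `Λ(π)⁻¹ ∫₀^∞ e^{-m h(t)} (1/m ∨ h(t)) ν(dt)`. -/
def distAverage {E : Type*} [MetricSpace E] (κ : ℝ) (S : ℝ → E → E)
    (ν : Measure ℝ) (ε : ℝ) (m : ℕ) (μ π : E) : ℝ :=
  (Lam κ S ν ε m μ π)⁻¹ *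
    ∫ t in Ici (0 : ℝ), Real.exp (-(m : ℝ) * hEps κ S ε π μ t) *
      max (1 / (m : ℝ)) (hEps κ S ε π μ t) ∂ν

/-- `f†(π) = (a/2) d²(π,ρ) - (b/m) log Λ(π) + c`. -/
def fDag {E : Type*} [MetricSpace E] (κ : ℝ) (S : ℝ → E → E) (ν : Measure ℝ)
    (a b c ε : ℝ) (m : ℕ) (ρ μ π : E) : ℝ :=
  1 / 2 * a * dist π ρ ^ 2 + b * (-(1 / (m : ℝ)) * Real.log (Lam κ S ν ε m μ π)) + c

open Classical in
/-- The function `g†`. Where `𝓔 π = +∞` the terms containing `-𝓔 π` have (strictly) positive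
coefficients and the others are finite, so the formula gives `-∞`. -/
def gDag {E : Type*} [MetricSpace E] (𝓔 : E → EReal) (κ : ℝ) (S : ℝ → E → E) (ν : Measure ℝ)
    (a b ε : ℝ) (m : ℕ) (ρ μ π : E) : EReal :=
  if 𝓔 π = ⊤ then ⊥
  else ((a * ((𝓔 ρ).toReal - (𝓔 π).toReal) - a * (κ / 2) * dist π ρ ^ 2
      + a ^ 2 / 2 * dist π ρ ^ 2 + a * b * dist π ρ + b ^ 2 / 2
      + b * energyAverage 𝓔 κ S ν ε m μ π
      - b * (kappaHat κ / 2) * distAverage κ S ν ε m μ π : ℝ) : EReal)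

/-- `f‡(μ) = -(a/2) d²(γ,μ) + (b/m) log Λ(μ) + c`, where the flow now starts at `π`. -/
def fDdag {E : Type*} [MetricSpace E] (κ : ℝ) (S : ℝ → E → E) (ν : Measure ℝ)
    (a b c ε : ℝ) (m : ℕ) (γ π μ : E) : ℝ :=
  -(1 / 2) * a * dist γ μ ^ 2 - b * (-(1 / (m : ℝ)) * Real.log (Lam κ S ν ε m π μ)) + c

open Classical in
/-- The function `g‡`; it is `+∞` where `𝓔 μ = +∞`. -/
def gDdag {E : Type*} [MetricSpace E] (𝓔 : E → EReal) (κ : ℝ) (S : ℝ → E → E) (ν : Measure ℝ)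
    (a b ε : ℝ) (m : ℕ) (γ π μ : E) : EReal :=
  if 𝓔 μ = ⊤ then ⊤
  else ((a * ((𝓔 μ).toReal - (𝓔 γ).toReal) + a * (κ / 2) * dist γ μ ^ 2
      + a ^ 2 / 2 * dist γ μ ^ 2 - a * b * dist γ μ - b ^ 2 / 2
      - b * energyAverage 𝓔 κ S ν ε m π μ
      + b * (kappaHat κ / 2) * distAverage κ S ν ε m π μ : ℝ) : EReal)

/-- `H_{2,†}`: the Riemann sum version. -/
def H2Dag {E : Type*} [MetricSpace E] (𝓔 : E → EReal) (κ : ℝ) (S : ℝ → E → E) :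
    Set ((E → ℝ) × (E → EReal)) :=
  {p | ∃ (ρ μ : E) (a b ε c : ℝ) (m n : ℕ), information 𝓔 ρ + information 𝓔 μ < ⊤ ∧
    0 < a ∧ 0 < b ∧ 0 < ε ∧ 1 ≤ m ∧ 1 ≤ n ∧
    p = (fDag κ S (discreteExpMeasure (m + 1) n) a b c ε m ρ μ,
      gDag 𝓔 κ S (discreteExpMeasure (m + 1) n) a b ε m ρ μ)}

/-- `H_{2,‡}`: the Riemann sum version. -/
def H2Ddag {E : Type*} [MetricSpace E] (𝓔 : E → EReal) (κ : ℝ) (S : ℝ → E → E) :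
    Set ((E → ℝ) × (E → EReal)) :=
  {p | ∃ (γ π : E) (a b ε c : ℝ) (m n : ℕ), information 𝓔 γ + information 𝓔 π < ⊤ ∧
    0 < a ∧ 0 < b ∧ 0 < ε ∧ 1 ≤ m ∧ 1 ≤ n ∧
    p = (fDdag κ S (discreteExpMeasure (m + 1) n) a b c ε m γ π,
      gDdag 𝓔 κ S (discreteExpMeasure (m + 1) n) a b ε m γ π)}

/-- `H_{3,†}`: the exact integral version. -/
def H3Dag {E : Type*} [MetricSpace E] (𝓔 : E → EReal) (κ : ℝ) (S : ℝ → E → E) :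
    Set ((E → ℝ) × (E → EReal)) :=
  {p | ∃ (ρ μ : E) (a b ε c : ℝ) (m : ℕ), information 𝓔 ρ + information 𝓔 μ < ⊤ ∧
    0 < a ∧ 0 < b ∧ 0 < ε ∧ 1 ≤ m ∧
    p = (fDag κ S (ProbabilityTheory.expMeasure ((m : ℝ) + 1)) a b c ε m ρ μ,
      gDag 𝓔 κ S (ProbabilityTheory.expMeasure ((m : ℝ) + 1)) a b ε m ρ μ)}

/-- `H_{3,‡}`: the exact integral version. -/
def H3Ddag {E : Type*} [MetricSpace E] (𝓔 : E → EReal) (κ : ℝ) (S : ℝ → E → E) :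
    Set ((E → ℝ) × (E → EReal)) :=
  {p | ∃ (γ π : E) (a b ε c : ℝ) (m : ℕ), information 𝓔 γ + information 𝓔 π < ⊤ ∧
    0 < a ∧ 0 < b ∧ 0 < ε ∧ 1 ≤ m ∧
    p = (fDdag κ S (ProbabilityTheory.expMeasure ((m : ℝ) + 1)) a b c ε m γ π,
      gDdag 𝓔 κ S (ProbabilityTheory.expMeasure ((m : ℝ) + 1)) a b ε m γ π)}

end TataruHJ

end

/-!
The test functions and Hamiltonians of `H₃` are limits of those of `H₂` as the Riemann sums become
exponential integrals, so the theorem is a stability statement for viscosity solutions.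

Points `x n` that are almost optimal for the `n`-th Riemann sum and almost satisfy its Hamiltonian
inequality stay at bounded distance from `ρ`, since the test functions grow like the squared
distance, and have bounded energy, since `g†` contains `-𝓔` (`bounds_of_fDag_le`,
`energy_le_of_le_realHam`). They lie in a weakly compact set and have a weak cluster point `x₀`. The
weak topology need not be sequential, so `exists_weak_limit` first extracts a subsequence along
which the countably many real data that matter converge (the energy, `u`, `h`, the distance to `ρ`
and the distances to the flow at rational times) and only uses that each of them is lower
semi-continuous (`-u` in the case of `u`) at the cluster point. With these data the limits of the
integrals are computed pointwise in time, by dominated convergence, and no weak continuity of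
integrals is involved. Comparing the limiting value of `u - f` with its value at `x₀` shows that no
inequality is strict: `x₀` maximises `u - f`, and the distances to `ρ` and, at almost every time, to
the flow converge to those of `x₀` (`limits_attained`).

The Hamiltonian inequality then passes to the limit (`realHam_limit`). The energy at `x n` and the
energy along the flow are only controlled from one side, but both enter with the favourable sign.
For the latter, the energy decreases along the flow (`IsEVISolution.energy_anti`), so the Riemann
sums at right endpoints of the energy loss dominate integrals to which Fatou's lemma applies
(`integral_le_of_expSum_le`); this also gives the integrability of the energy loss, which no growth
bound has to provide. The constant sequence `x₀` verifies the definition for `H₃`.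

Supersolutions reduce to the same argument for `-v`, because `f‡` and `g‡` are the negatives of
`f†` and `g†` up to the sign of the term `a² d² / 2`, whose limit is a genuine limit.
-/

namespace TataruHJ

open MeasureTheory Filter Topology Set

/-! ### The function `psi` -/

section Psi

variable {ε : ℝ}

/-- The polynomial branch of `psi`, with the power `3 / 2` rewritten in terms of `√(2 * ε)`. -/
lemma psi_of_le (hε : 0 < ε) {r : ℝ} (hr : r ≤ ε) :
    psi ε r = √(2 * ε) + (r - ε) / √(2 * ε) - (r - ε) ^ 2 / (2 * √(2 * ε) ^ 3) := by
  have h3 : (2 * ε) ^ (3 / 2 : ℝ) = √(2 * ε) ^ 3 := by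
    rw [Real.sqrt_eq_rpow, ← Real.rpow_natCast, ← Real.rpow_mul (by positivity)]
    norm_num
  rw [psi, if_pos hr, h3]

/-- The derivative of `psi ε`. -/
noncomputable def psiDeriv (ε r : ℝ) : ℝ :=
  if r ≤ ε then 1 / √(2 * ε) - (r - ε) / √(2 * ε) ^ 3 else 1 / √(2 * r)

lemma hasDerivAt_psi (hε : 0 < ε) (r : ℝ) : HasDerivAt (psi ε) (psiDeriv ε r) r := by
  have hs : 0 < √(2 * ε) := by positivity
  have hquad : ∀ x, HasDerivAt
      (fun r => √(2 * ε) + (r - ε) / √(2 * ε) - (r - ε) ^ 2 / (2 * √(2 * ε) ^ 3))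
      (1 / √(2 * ε) - (x - ε) / √(2 * ε) ^ 3) x := by
    intro x
    have h1 := (hasDerivAt_id x).sub_const ε
    have h2 := ((h1.div_const √(2 * ε)).const_add √(2 * ε)).sub
      ((h1.pow 2).div_const (2 * √(2 * ε) ^ 3))
    refine h2.congr_deriv ?_
    simp only [id, Nat.cast_ofNat, Nat.add_one_sub_one, pow_one]
    field_simp
  have hsqrt : ∀ x, 0 < x → HasDerivAt (fun r => √(2 * r)) (1 / √(2 * x)) x := by
    intro x hx
    have h1 := ((hasDerivAt_id' x).const_mul 2).sqrt (by simpa using hx.ne')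
    refine h1.congr_deriv ?_
    field_simp
  rcases lt_trichotomy r ε with h | h | h
  · rw [psiDeriv, if_pos h.le]
    refine (hquad r).congr_of_eventuallyEq ?_
    filter_upwards [Iio_mem_nhds h] with x hx using psi_of_le hε (le_of_lt hx)
  · subst h
    have h1 : HasDerivWithinAt (psi r) (psiDeriv r r) (Iic r) r := by
      rw [psiDeriv, if_pos le_rfl]
      exact (hquad r).hasDerivWithinAt.congr (fun x hx => psi_of_le hε hx) (psi_of_le hε le_rfl)
    have h2 : HasDerivWithinAt (psi r) (psiDeriv r r) (Ici r) r := by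
      have hr : psi r r = √(2 * r) := by rw [psi_of_le hε le_rfl]; simp
      have : psiDeriv r r = 1 / √(2 * r) := by rw [psiDeriv, if_pos le_rfl]; simp
      rw [this]
      refine (hsqrt r hε).hasDerivWithinAt.congr (fun x hx => ?_) hr
      rcases eq_or_lt_of_le (show r ≤ x from hx) with h | h
      · rw [← h, hr]
      · rw [psi, if_neg (not_le.2 h)]
    have h3 := h1.union h2
    rwa [Iic_union_Ici, hasDerivWithinAt_univ] at h3
  · rw [psiDeriv, if_neg (not_le.2 h)]
    refine (hsqrt r (hε.trans h)).congr_of_eventuallyEq ?_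
    filter_upwards [Ioi_mem_nhds h] with x hx
    rw [psi, if_neg (not_le.2 hx)]

lemma deriv_psi (hε : 0 < ε) : deriv (psi ε) = psiDeriv ε :=
  funext fun r => (hasDerivAt_psi hε r).deriv

lemma psiDeriv_pos (hε : 0 < ε) (r : ℝ) : 0 < psiDeriv ε r := by
  have hs : 0 < √(2 * ε) := by positivity
  rw [psiDeriv]
  split_ifs with h
  · have : (r - ε) / √(2 * ε) ^ 3 ≤ 0 :=
      div_nonpos_of_nonpos_of_nonneg (by linarith) (by positivity)
    have : 0 < 1 / √(2 * ε) := by positivity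
    linarith
  · have : 0 < r := hε.trans (not_le.1 h)
    positivity

lemma psiDeriv_le (hε : 0 < ε) {r : ℝ} (hr : 0 ≤ r) : psiDeriv ε r ≤ 2 / √(2 * ε) := by
  have hs : 0 < √(2 * ε) := by positivity
  have hs2 : √(2 * ε) ^ 2 = 2 * ε := Real.sq_sqrt (by positivity)
  rw [psiDeriv]
  split_ifs with h
  · have h1 : -(1 / √(2 * ε)) ≤ (r - ε) / √(2 * ε) ^ 3 := by
      rw [← neg_div, div_le_div_iff₀ hs (by positivity)]
      have : √(2 * ε) ^ 3 = √(2 * ε) * (2 * ε) := by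
        rw [pow_succ, hs2, mul_comm]
      rw [this]
      nlinarith
    have h2 : 2 / √(2 * ε) = 1 / √(2 * ε) + 1 / √(2 * ε) := by ring
    linarith
  · have : √(2 * ε) ≤ √(2 * r) := Real.sqrt_le_sqrt (by linarith [not_le.1 h])
    exact div_le_div₀ (by norm_num) (by norm_num) hs this

lemma continuous_psi (hε : 0 < ε) : Continuous (psi ε) :=
  continuous_iff_continuousAt.2 fun r => (hasDerivAt_psi hε r).continuousAt

lemma continuous_psiDeriv (hε : 0 < ε) : Continuous (psiDeriv ε) := by
  have hs : 0 < √(2 * ε) := by positivity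
  refine continuous_iff_continuousAt.2 fun r => ?_
  have h1 : Continuous fun r => 1 / √(2 * ε) - (r - ε) / √(2 * ε) ^ 3 := by fun_prop
  -- clamping `r` below at `ε` makes the square root branch continuous everywhere
  have h2 : Continuous fun r => 1 / √(2 * max ε r) := by
    refine continuous_const.div (by fun_prop) fun x => ?_
    have : 0 < max ε x := lt_max_of_lt_left hε
    positivity
  have h3 : psiDeriv ε = fun r =>
      if r ≤ ε then 1 / √(2 * ε) - (r - ε) / √(2 * ε) ^ 3 else 1 / √(2 * max ε r) := by
    funext x
    rw [psiDeriv]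
    split_ifs with h
    · rfl
    · rw [max_eq_right (not_le.1 h).le]
  rw [h3]
  refine (Continuous.if_le h1 h2 continuous_id continuous_const ?_).continuousAt
  rintro x rfl
  simp

lemma strictMono_psi (hε : 0 < ε) : StrictMono (psi ε) :=
  strictMono_of_deriv_pos fun r => by rw [deriv_psi hε]; exact psiDeriv_pos hε r

lemma psi_nonneg (hε : 0 < ε) {r : ℝ} (hr : 0 ≤ r) : 0 ≤ psi ε r := by
  refine le_trans ?_ ((strictMono_psi hε).monotone hr)
  have hs : 0 < √(2 * ε) := by positivity
  have hs2 : √(2 * ε) ^ 2 = 2 * ε := Real.sq_sqrt (by positivity)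
  have hε' : ε = √(2 * ε) ^ 2 / 2 := by linarith
  rw [psi_of_le hε hε.le]
  generalize √(2 * ε) = s at *
  subst hε'
  have : s + (0 - s ^ 2 / 2) / s - (0 - s ^ 2 / 2) ^ 2 / (2 * s ^ 3) = 3 / 8 * s := by
    field_simp
    ring
  rw [this]
  positivity

end Psi

/-! ### The energy decreases along the flow -/

/-- A solution of the evolution variational inequality started from a point of finite energy has
non-increasing energy. If the energy exceeded its value at `s` at a later time `t`, let `r` be the
last time before `t` at which it does not. The inequality tested with `γ r` then bounds the growth
of the squared distance to `γ r` after `r`, and Gronwall's lemma forces `γ t = γ r`. -/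
lemma IsEVISolution.energy_anti {E : Type*} [MetricSpace E] {𝓔 : E → EReal} {κ : ℝ}
    {γ : ℝ → E} (hγ : IsEVISolution 𝓔 κ γ) (hbot : ∀ π, 𝓔 π ≠ ⊥) (hlsc : LowerSemicontinuous 𝓔)
    (h0 : 𝓔 (γ 0) ≠ ⊤) {s t : ℝ} (hs : 0 ≤ s) (hst : s ≤ t) : 𝓔 (γ t) ≤ 𝓔 (γ s) := by
  have hfin : ∀ r, 0 ≤ r → 𝓔 (γ r) ≠ ⊤ := by
    intro r hr
    rcases eq_or_lt_of_le hr with h | h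
    · rwa [← h]
    · exact hγ.mem_domain r h
  by_contra hcon
  rw [not_le] at hcon
  have hsub : Icc s t ⊆ Ici 0 := fun x hx => hs.trans hx.1
  have hcont : ContinuousOn γ (Icc s t) := hγ.continuousOn.mono hsub
  let A : Set ℝ := Icc s t ∩ {r | 𝓔 (γ r) ≤ 𝓔 (γ s)}
  have hA : IsCompact A := by
    refine isCompact_Icc.of_isClosed_subset ?_ inter_subset_left
    exact hcont.preimage_isClosed_of_isClosed isClosed_Icc (hlsc.isClosed_preimage (𝓔 (γ s)))
  obtain ⟨r, ⟨⟨hr1, hr2⟩, hr3⟩, hrmax⟩ := hA.exists_isGreatest ⟨s, ⟨le_rfl, hst⟩, le_refl (𝓔 (γ s))⟩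
  have hr0 : 0 ≤ r := hs.trans hr1
  have hgt : ∀ x ∈ Icc r t, 𝓔 (γ r) ≤ 𝓔 (γ x) := by
    intro x hx
    rcases eq_or_lt_of_le hx.1 with h | h
    · rw [h]
    · by_contra hlt
      have hxA : x ∈ A := ⟨⟨hr1.trans hx.1, hx.2⟩, (not_le.1 hlt).le.trans hr3⟩
      exact absurd (hrmax hxA) (not_le.2 h)
  have hgr := le_gronwallBound_of_liminf_deriv_right_le (f := fun x => dist (γ x) (γ r) ^ 2)
    (f' := fun x => -κ * dist (γ x) (γ r) ^ 2) (δ := 0) (K := -κ) (ε := 0) (a := r) (b := t)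
    ((continuous_dist.comp_continuousOn
      ((hcont.mono (Icc_subset_Icc_left hr1)).prodMk continuousOn_const)).pow 2) ?_ (by simp)
    (by intros; simp)
  · have := hgr t ⟨hr2, le_rfl⟩
    have h0 : dist (γ t) (γ r) = 0 := by
      rw [gronwallBound_ε0_δ0] at this
      exact pow_eq_zero_iff (two_ne_zero) |>.1 (le_antisymm this (by positivity))
    rw [dist_eq_zero] at h0
    rw [h0] at hcon
    exact absurd hr3 (not_le.2 hcon)
  · intro x hx q hq
    have hx0 : 0 ≤ x := hr0.trans hx.1
    have hevi := hγ.evi (γ r) (hfin r hr0) x hx0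
    have hle : upperRightDeriv (fun y => dist (γ y) (γ r) ^ 2) x
        ≤ ((-κ * dist (γ x) (γ r) ^ 2 : ℝ) : EReal) := by
      have h1 := hgt x ⟨hx.1, hx.2.le⟩
      lift 𝓔 (γ r) to ℝ using ⟨hfin r hr0, hbot _⟩ with e1
      lift 𝓔 (γ x) to ℝ using ⟨hfin x hx0, hbot _⟩ with e2
      generalize upperRightDeriv (fun y => dist (γ y) (γ r) ^ 2) x = D at hevi
      induction D with
      | bot => exact bot_le
      | top =>
        rw [EReal.coe_mul_top_of_pos (by norm_num)] at hevi
        norm_cast at hevi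
      | coe d =>
        norm_cast at *
        linarith
    have hev : ∀ᶠ y in 𝓝[>] (0 : ℝ),
        (dist (γ (x + y)) (γ r) ^ 2 - dist (γ x) (γ r) ^ 2) / y < q := by
      have := eventually_lt_of_limsup_lt (lt_of_le_of_lt hle (EReal.coe_lt_coe_iff.2 hq))
      filter_upwards [this] with y hy using EReal.coe_lt_coe_iff.1 hy
    refine Eventually.frequently ?_
    have hmap : Tendsto (fun z : ℝ => z - x) (𝓝[>] x) (𝓝[>] 0) := by
      refine tendsto_nhdsWithin_iff.2 ⟨?_, ?_⟩
      · have : Tendsto (fun z : ℝ => z - x) (𝓝 x) (𝓝 (x - x)) :=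
          tendsto_id.sub tendsto_const_nhds
        rw [sub_self] at this
        exact this.mono_left nhdsWithin_le_nhds
      · filter_upwards [self_mem_nhdsWithin] with z hz using sub_pos.2 (mem_Ioi.1 hz)
    filter_upwards [hmap.eventually hev] with z hz
    rw [add_sub_cancel] at hz
    rwa [inv_mul_eq_div]

lemma energy_ne_top_of_information_lt {E : Type*} [MetricSpace E] {𝓔 : E → EReal} {ρ : E}
    (h : information 𝓔 ρ < ⊤) : 𝓔 ρ ≠ ⊤ := by
  intro h'
  simp [information, localSlope, h'] at h

/-! ### Riemann sums for the exponential distribution -/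

/-- The smallest multiple of `1 / N` that is at least `t`, for `t ≥ 0`. -/
noncomputable def gridCeil (N : ℕ) (t : ℝ) : ℝ := (⌈(N : ℝ) * t⌉₊ : ℝ) / N

lemma gridCeil_nonneg (N : ℕ) (t : ℝ) : 0 ≤ gridCeil N t := by unfold gridCeil; positivity

lemma le_gridCeil {N : ℕ} (hN : 1 ≤ N) (t : ℝ) : t ≤ gridCeil N t := by
  have hN' : (0 : ℝ) < N := by exact_mod_cast hN
  rw [gridCeil, le_div_iff₀ hN', mul_comm]
  exact Nat.le_ceil _

lemma measurable_comp_gridCeil {β : Type*} [MeasurableSpace β] (N : ℕ) (g : ℝ → β) :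
    Measurable fun t => g (gridCeil N t) :=
  (measurable_from_nat (f := fun k : ℕ => g ((k : ℝ) / N))).comp
    (Nat.measurable_ceil.comp (measurable_const_mul (N : ℝ)))

lemma tendsto_gridCeil {N : ℕ → ℕ} (hN : Tendsto N atTop atTop) {t : ℝ} (ht : 0 ≤ t) :
    Tendsto (fun k => gridCeil (N k) t) atTop (𝓝 t) := by
  have := (tendsto_nat_ceil_mul_div_atTop ht).comp (tendsto_natCast_atTop_atTop.comp hN)
  refine this.congr fun k => ?_
  simp [gridCeil, mul_comm]

lemma integral_gridCeil {N : ℕ} (hN : 1 ≤ N) (g : ℝ → ℝ) :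
    IntegrableOn ((Iic (N : ℝ)).indicator fun t => g (gridCeil N t)) (Ioi 0) ∧
    ∫ t in Ioi (0 : ℝ), (Iic (N : ℝ)).indicator (fun t => g (gridCeil N t)) t
      = (1 / N : ℝ) * ∑ i ∈ Finset.Icc 1 (N ^ 2), g ((i : ℝ) / N) := by
  have hN' : (0 : ℝ) < N := by exact_mod_cast hN
  have hcell : ∀ k : ℕ, EqOn (fun _ => g (((k + 1 : ℕ) : ℝ) / N)) (fun t => g (gridCeil N t))
      (Ioc ((k : ℝ) / N) (((k + 1 : ℕ) : ℝ) / N)) := by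
    intro k t ht
    have : ⌈(N : ℝ) * t⌉₊ = k + 1 := by
      rw [Nat.ceil_eq_iff (by omega)]
      have h1 := (div_lt_iff₀ hN').1 ht.1
      have h2 := (le_div_iff₀ hN').1 ht.2
      rw [mul_comm]
      exact ⟨by simpa using h1, h2⟩
    simp only [gridCeil, this]
  have hle : ∀ k : ℕ, (k : ℝ) / N ≤ ((k + 1 : ℕ) : ℝ) / N := fun k => by
    gcongr
    omega
  have hint : ∀ k : ℕ, IntervalIntegrable (fun t => g (gridCeil N t)) volume
      ((k : ℝ) / N) (((k + 1 : ℕ) : ℝ) / N) := by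
    intro k
    refine (intervalIntegrable_const (c := g (((k + 1 : ℕ) : ℝ) / N))).congr ?_
    rw [uIoc_of_le (hle k)]
    exact hcell k
  have hval : ∀ k : ℕ, ∫ t in ((k : ℝ) / N)..(((k + 1 : ℕ) : ℝ) / N), g (gridCeil N t)
      = (1 / N : ℝ) * g (((k + 1 : ℕ) : ℝ) / N) := by
    intro k
    rw [intervalIntegral.integral_of_le (hle k),
      ← setIntegral_congr_fun measurableSet_Ioc (hcell k),
      ← intervalIntegral.integral_of_le (hle k),
      intervalIntegral.integral_const, smul_eq_mul]
    push_cast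
    ring
  have hend : ((N ^ 2 : ℕ) : ℝ) / N = N := by
    push_cast
    field_simp
  have hset : Ioi (0 : ℝ) ∩ Iic (N : ℝ) = Ioc 0 (N : ℝ) := rfl
  constructor
  · have := IntervalIntegrable.trans_iterate (a := fun k : ℕ => (k : ℝ) / N) (n := N ^ 2)
      (f := fun t => g (gridCeil N t)) (μ := volume) fun k _ => hint k
    simp only [hend, Nat.cast_zero, zero_div] at this
    rw [intervalIntegrable_iff_integrableOn_Ioc_of_le hN'.le] at this
    rw [IntegrableOn, integrable_indicator_iff measurableSet_Iic, IntegrableOn,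
      Measure.restrict_restrict measurableSet_Iic, inter_comm, hset]
    exact this
  · have := intervalIntegral.sum_integral_adjacent_intervals
      (a := fun k : ℕ => (k : ℝ) / N) (n := N ^ 2)
      (f := fun t => g (gridCeil N t)) (μ := volume) fun k _ => hint k
    simp only [hend, Nat.cast_zero, zero_div, hval] at this
    rw [setIntegral_indicator measurableSet_Iic, hset, ← intervalIntegral.integral_of_le hN'.le,
      ← this, ← Finset.mul_sum, Finset.range_eq_Ico,
      Finset.sum_Ico_add' (fun i : ℕ => g ((i : ℝ) / N))]
    congr 1

/-- The Riemann sum at the points `i / N`, `1 ≤ i ≤ N ^ 2`, of `∫₀^∞ e^{-Mt} g(t) dt`. -/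
noncomputable def expSum (M : ℝ) (N : ℕ) (g : ℝ → ℝ) : ℝ :=
  (1 / N : ℝ) * ∑ i ∈ Finset.Icc 1 (N ^ 2), Real.exp (-M * ((i : ℝ) / N)) * g ((i : ℝ) / N)

lemma expSum_mono {M : ℝ} {N : ℕ} {f g : ℝ → ℝ} (h : ∀ t, 0 ≤ t → f t ≤ g t) :
    expSum M N f ≤ expSum M N g := by
  unfold expSum
  gcongr with i _
  exact h _ (by positivity)

lemma expSum_const_mul (M : ℝ) (N : ℕ) (c : ℝ) (g : ℝ → ℝ) :
    expSum M N (fun t => c * g t) = c * expSum M N g := by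
  unfold expSum
  simp only [Finset.mul_sum]
  exact Finset.sum_congr rfl fun i _ => by ring

lemma expSum_sub (M : ℝ) (N : ℕ) (f g : ℝ → ℝ) :
    expSum M N (fun t => f t - g t) = expSum M N f - expSum M N g := by
  unfold expSum
  rw [← mul_sub, ← Finset.sum_sub_distrib]
  simp only [mul_sub]

lemma expSum_nonneg {M : ℝ} {N : ℕ} {g : ℝ → ℝ} (h : ∀ t, 0 ≤ t → 0 ≤ g t) :
    0 ≤ expSum M N g := by
  unfold expSum
  refine mul_nonneg (by positivity) (Finset.sum_nonneg fun i _ => ?_)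
  exact mul_nonneg (Real.exp_pos _).le (h _ (by positivity))

lemma expSum_pos {M : ℝ} {N : ℕ} (hN : 1 ≤ N) {g : ℝ → ℝ} (h : ∀ t, 0 ≤ t → 0 < g t) :
    0 < expSum M N g := by
  unfold expSum
  have hN' : (0 : ℝ) < N := by exact_mod_cast hN
  refine mul_pos (by positivity) (Finset.sum_pos (fun i _ => ?_) ?_)
  · exact mul_pos (Real.exp_pos _) (h _ (by positivity))
  · exact ⟨1, Finset.mem_Icc.2 ⟨le_rfl, Nat.one_le_pow _ _ hN⟩⟩

/-- Dominated convergence for Riemann sums of a varying integrand. -/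
lemma tendsto_expSum {M : ℝ} (hM : 0 < M) {N : ℕ → ℕ} (hN1 : ∀ k, 1 ≤ N k)
    (hN : Tendsto N atTop atTop) {g : ℕ → ℝ → ℝ} {G : ℝ → ℝ} {C : ℝ}
    (hC : ∀ k t, 0 ≤ t → |g k t| ≤ C)
    (hg : ∀ t, 0 < t → Tendsto (fun k => g k (gridCeil (N k) t)) atTop (𝓝 (G t))) :
    Tendsto (fun k => expSum M (N k) (g k)) atTop
      (𝓝 (∫ t in Ioi (0 : ℝ), Real.exp (-M * t) * G t)) := by
  have hC0 : 0 ≤ C := (abs_nonneg _).trans (hC 0 0 le_rfl)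
  simp only [expSum]
  simp_rw [fun k => ((integral_gridCeil (hN1 k) (fun t => Real.exp (-M * t) * g k t)).2).symm]
  refine tendsto_integral_of_dominated_convergence (fun t => Real.exp (-M * t) * C) (fun k => ?_) ?_
    (fun k => ?_) ?_
  · exact (integral_gridCeil (hN1 k) (fun t => Real.exp (-M * t) * g k t)).1.aestronglyMeasurable
  · exact (exp_neg_integrableOn_Ioi 0 hM).mul_const C
  · refine Eventually.of_forall fun t => ?_
    refine (norm_indicator_le_norm_self _ _).trans ?_
    rw [Real.norm_eq_abs, abs_mul, abs_of_pos (Real.exp_pos _)]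
    refine mul_le_mul (Real.exp_le_exp.2 ?_) (hC k _ (gridCeil_nonneg _ _)) (abs_nonneg _)
      (Real.exp_pos _).le
    have := le_gridCeil (hN1 k) t
    nlinarith
  · filter_upwards [ae_restrict_mem measurableSet_Ioi] with t ht
    have h1 : Tendsto (fun k => Real.exp (-M * gridCeil (N k) t) * g k (gridCeil (N k) t)) atTop
        (𝓝 (Real.exp (-M * t) * G t)) := by
      refine Tendsto.mul ?_ (hg t ht)
      exact (Real.continuous_exp.tendsto _).comp ((tendsto_gridCeil hN (le_of_lt ht)).const_mul _)
    refine h1.congr' ?_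
    filter_upwards [(tendsto_natCast_atTop_atTop.comp hN).eventually_ge_atTop t] with k hk
    rw [indicator_of_mem (show t ∈ Iic (N k : ℝ) from hk)]

/-- Fatou's lemma for Riemann sums of `g k * e`. No continuity of `e` is needed: `e` is monotone
and the sums use right endpoints, so they dominate the integrals of `g k (gridCeil (N k) ·) * e`. -/
lemma integral_le_of_expSum_le {M : ℝ} {N : ℕ → ℕ} (hN1 : ∀ k, 1 ≤ N k)
    (hN : Tendsto N atTop atTop) {g : ℕ → ℝ → ℝ} {G e : ℝ → ℝ}
    (hg0 : ∀ k t, 0 ≤ t → 0 ≤ g k t) (he : MonotoneOn e (Ioi 0)) (he0 : ∀ t, 0 < t → 0 ≤ e t)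
    (hg : ∀ t, 0 < t → Tendsto (fun k => g k (gridCeil (N k) t)) atTop (𝓝 (G t)))
    {R : ℕ → ℝ} {r : ℝ} (hR : ∀ k, expSum M (N k) (fun t => g k t * e t) ≤ R k)
    (hr : Tendsto R atTop (𝓝 r)) :
    IntegrableOn (fun t => Real.exp (-M * t) * (G t * e t)) (Ioi 0) ∧
      ∫ t in Ioi (0 : ℝ), Real.exp (-M * t) * (G t * e t) ≤ r := by
  let F : ℕ → ℝ → ℝ := fun k => (Iic (N k : ℝ)).indicator fun t =>
    Real.exp (-M * gridCeil (N k) t) * g k (gridCeil (N k) t)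
  have hFm : ∀ k, Measurable (F k) := fun k =>
    (measurable_comp_gridCeil (N k) (fun t => Real.exp (-M * t) * g k t)).indicator
      measurableSet_Iic
  have hF0 : ∀ k t, 0 ≤ F k t := fun k t => indicator_nonneg
    (fun t _ => mul_nonneg (Real.exp_pos _).le (hg0 k _ (gridCeil_nonneg _ _))) t
  have hFlim : ∀ t, 0 < t → Tendsto (fun k => F k t) atTop (𝓝 (Real.exp (-M * t) * G t)) := by
    intro t ht
    have h1 : Tendsto (fun k => Real.exp (-M * gridCeil (N k) t) * g k (gridCeil (N k) t)) atTop
        (𝓝 (Real.exp (-M * t) * G t)) := by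
      refine Tendsto.mul ?_ (hg t ht)
      exact (Real.continuous_exp.tendsto _).comp ((tendsto_gridCeil hN (le_of_lt ht)).const_mul _)
    refine h1.congr' ?_
    filter_upwards [(tendsto_natCast_atTop_atTop.comp hN).eventually_ge_atTop t] with k hk
    simp only [F]
    rw [indicator_of_mem (show t ∈ Iic (N k : ℝ) from hk)]
  have hem : AEMeasurable e (volume.restrict (Ioi 0)) :=
    aemeasurable_restrict_of_monotoneOn measurableSet_Ioi he
  have hle : ∀ k, ∫⁻ t in Ioi (0 : ℝ), ENNReal.ofReal (F k t * e t) ≤ ENNReal.ofReal (R k) := by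
    intro k
    have hI := integral_gridCeil (hN1 k) (fun t => Real.exp (-M * t) * (g k t * e t))
    have hnn : ∀ t, 0 < t → 0 ≤ (Iic (N k : ℝ)).indicator (fun t =>
        Real.exp (-M * gridCeil (N k) t) * (g k (gridCeil (N k) t) * e (gridCeil (N k) t))) t := by
      intro t ht
      refine indicator_apply_nonneg fun _ => ?_
      exact mul_nonneg (Real.exp_pos _).le (mul_nonneg (hg0 k _ (gridCeil_nonneg _ _))
        (he0 _ (ht.trans_le (le_gridCeil (hN1 k) t))))
    calc ∫⁻ t in Ioi (0 : ℝ), ENNReal.ofReal (F k t * e t)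
        ≤ ∫⁻ t in Ioi (0 : ℝ), ENNReal.ofReal ((Iic (N k : ℝ)).indicator (fun t =>
        Real.exp (-M * gridCeil (N k) t) * (g k (gridCeil (N k) t) * e (gridCeil (N k) t))) t) := by
          refine setLIntegral_mono' measurableSet_Ioi fun t ht => ENNReal.ofReal_le_ofReal ?_
          have ht' : (0 : ℝ) < t := ht
          simp only [F]
          by_cases htN : t ∈ Iic (N k : ℝ)
          · rw [indicator_of_mem htN, indicator_of_mem htN, ← mul_assoc]
            refine mul_le_mul_of_nonneg_left
              (he ht' (ht'.trans_le (le_gridCeil (hN1 k) t)) (le_gridCeil (hN1 k) t)) ?_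
            exact mul_nonneg (Real.exp_pos _).le (hg0 k _ (gridCeil_nonneg _ _))
          · simp [indicator_of_notMem htN]
      _ = ENNReal.ofReal (expSum M (N k) (fun t => g k t * e t)) := by
          rw [← ofReal_integral_eq_lintegral_ofReal hI.1, hI.2]
          · rfl
          · filter_upwards [ae_restrict_mem measurableSet_Ioi] with t ht using hnn t ht
      _ ≤ ENNReal.ofReal (R k) := ENNReal.ofReal_le_ofReal (hR k)
  have hlim : ∫⁻ t in Ioi (0 : ℝ), ENNReal.ofReal (Real.exp (-M * t) * (G t * e t))
      ≤ ENNReal.ofReal r := by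
    calc ∫⁻ t in Ioi (0 : ℝ), ENNReal.ofReal (Real.exp (-M * t) * (G t * e t))
        = ∫⁻ t in Ioi (0 : ℝ), liminf (fun k => ENNReal.ofReal (F k t * e t)) atTop := by
          refine setLIntegral_congr_fun measurableSet_Ioi fun t ht => ?_
          have := ((hFlim t ht).mul_const (e t))
          rw [mul_assoc] at this
          exact ((ENNReal.continuous_ofReal.tendsto _).comp this).liminf_eq.symm
      _ ≤ liminf (fun k => ∫⁻ t in Ioi (0 : ℝ), ENNReal.ofReal (F k t * e t)) atTop :=
          lintegral_liminf_le' fun k =>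
            (((hFm k).aemeasurable.mul hem)).ennreal_ofReal
      _ ≤ liminf (fun k => ENNReal.ofReal (R k)) atTop :=
          liminf_le_liminf (Eventually.of_forall hle)
      _ = ENNReal.ofReal r := ((ENNReal.continuous_ofReal.tendsto _).comp hr).liminf_eq
  have hnn : 0 ≤ᵐ[volume.restrict (Ioi 0)] fun t => Real.exp (-M * t) * (G t * e t) := by
    filter_upwards [ae_restrict_mem measurableSet_Ioi] with t ht
    have : 0 ≤ Real.exp (-M * t) * G t := ge_of_tendsto' (hFlim t ht) fun k => hF0 k t
    have h2 := mul_nonneg this (he0 t ht)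
    rwa [mul_assoc] at h2
  have hmeas : AEStronglyMeasurable (fun t => Real.exp (-M * t) * (G t * e t))
      (volume.restrict (Ioi 0)) := by
    have h1 : AEMeasurable (fun t => Real.exp (-M * t) * G t) (volume.restrict (Ioi 0)) := by
      refine aemeasurable_of_tendsto_metrizable_ae atTop (fun k => (hFm k).aemeasurable) ?_
      filter_upwards [ae_restrict_mem measurableSet_Ioi] with t ht using hFlim t ht
    have h2 := (h1.mul hem).aestronglyMeasurable
    refine h2.congr (Eventually.of_forall fun t => ?_)
    simp [mul_assoc]
  have hr0 : 0 ≤ r := ge_of_tendsto' hr fun k => by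
    refine le_trans ?_ (hR k)
    have hI := integral_gridCeil (hN1 k) (fun t => Real.exp (-M * t) * (g k t * e t))
    refine le_of_le_of_eq ?_ hI.2
    refine setIntegral_nonneg measurableSet_Ioi fun t ht => indicator_apply_nonneg fun _ => ?_
    exact mul_nonneg (Real.exp_pos _).le (mul_nonneg (hg0 k _ (gridCeil_nonneg _ _))
        (he0 _ (lt_of_lt_of_le ht (le_gridCeil (hN1 k) t))))
  refine ⟨⟨hmeas, ?_⟩, ?_⟩
  · rw [hasFiniteIntegral_iff_ofReal hnn]
    exact hlim.trans_lt ENNReal.ofReal_lt_top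
  · rw [integral_eq_lintegral_of_nonneg_ae hnn hmeas]
    exact ENNReal.toReal_le_of_le_ofReal hr0 hlim

lemma integral_discreteExpMeasure (M : ℕ) {N : ℕ} (hN : 1 ≤ N) (g : ℝ → ℝ) :
    ∫ t in Ici (0 : ℝ), g t ∂(discreteExpMeasure M N)
      = (expSum M N fun _ => 1)⁻¹ * expSum M N g := by
  have hN' : (0 : ℝ) < N := by exact_mod_cast hN
  have hres : (discreteExpMeasure M N).restrict (Ici 0) = discreteExpMeasure M N := by
    refine Measure.restrict_eq_self_of_ae_mem ?_
    rw [discreteExpMeasure, ae_finsetSum_measure_iff]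
    intro i _
    refine Measure.ae_smul_measure ?_ _
    rw [ae_dirac_eq]
    exact (show (0 : ℝ) ≤ (i : ℝ) / N by positivity)
  rw [hres, discreteExpMeasure, integral_finsetSum_measure]
  · simp only [expSum, integral_smul_measure, integral_dirac, smul_eq_mul, mul_one]
    rw [mul_inv, mul_mul_mul_comm, inv_mul_cancel₀ (by positivity), one_mul, Finset.mul_sum]
    refine Finset.sum_congr rfl fun i _ => ?_
    rw [ENNReal.toReal_ofReal (by positivity), mul_assoc]
  · intro i _
    refine Integrable.smul_measure ?_ ENNReal.ofReal_ne_top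
    exact integrable_dirac (by simp)

lemma integral_expMeasure {M : ℝ} (hM : 0 < M) (g : ℝ → ℝ) :
    ∫ t in Ici (0 : ℝ), g t ∂(ProbabilityTheory.expMeasure M)
      = M * ∫ t in Ioi (0 : ℝ), Real.exp (-M * t) * g t := by
  have hmeas : Measurable (ProbabilityTheory.gammaPDF 1 M) :=
    (ProbabilityTheory.measurable_gammaPDFReal 1 M).ennreal_ofReal
  rw [ProbabilityTheory.expMeasure, ProbabilityTheory.gammaMeasure,
    setIntegral_withDensity_eq_setIntegral_toReal_smul hmeas
      (Eventually.of_forall fun _ => ENNReal.ofReal_lt_top) _ measurableSet_Ici,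
    integral_Ici_eq_integral_Ioi, ← integral_const_mul]
  refine setIntegral_congr_fun measurableSet_Ioi fun t ht => ?_
  have ht' : (0 : ℝ) < t := ht
  simp only [ProbabilityTheory.gammaPDF, ProbabilityTheory.gammaPDFReal, if_pos ht'.le, smul_eq_mul]
  rw [ENNReal.toReal_ofReal (by simp; positivity)]
  simp
  ring

lemma integral_exp_neg_mul {M : ℝ} (hM : 0 < M) :
    ∫ t in Ioi (0 : ℝ), Real.exp (-M * t) * 1 = M⁻¹ := by
  simp only [mul_one]
  rw [integral_exp_mul_Ioi (by linarith) 0]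
  simp [neg_div_neg_eq]

/-- The normalising factor of the discrete measures converges to that of the exponential law. -/
lemma tendsto_expSum_one {M : ℝ} (hM : 0 < M) {N : ℕ → ℕ} (hN1 : ∀ k, 1 ≤ N k)
    (hN : Tendsto N atTop atTop) :
    Tendsto (fun k => (expSum M (N k) fun _ => 1)⁻¹) atTop (𝓝 M) := by
  have := tendsto_expSum hM hN1 hN (g := fun _ _ => 1) (G := fun _ => 1) (C := 1) (by simp)
    (fun _ _ => tendsto_const_nhds)
  rw [integral_exp_neg_mul hM] at this
  simpa using this.inv₀ (by positivity)

/-! ### Extraction of a limit point -/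

/-- Compactness in a topology that need not be sequential. A sequence in a compact set has a
subsequence along which countably many given lower semi-continuous functions converge, and a point
of the set at which they are at most their limits. The point itself is only a cluster point. -/
lemma exists_subseq_tendsto_of_isCompact {X ι : Type*} [TopologicalSpace X] [Countable ι]
    {K : Set X} (hK : IsCompact K) {x : ℕ → X} (hx : ∀ n, x n ∈ K) {Φ : ι → X → EReal}
    (hΦ : ∀ i, LowerSemicontinuousOn (Φ i) K) :
    ∃ x₀ ∈ K, ∃ φ : ℕ → ℕ, StrictMono φ ∧ ∃ L : ι → EReal,
      (∀ i, Tendsto (fun n => Φ i (x (φ n))) atTop (𝓝 (L i))) ∧ ∀ i, Φ i x₀ ≤ L i := by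
  obtain ⟨L, φ, hφ, hL⟩ := CompactSpace.tendsto_subseq (fun n i => Φ i (x n))
  have hL' : ∀ i, Tendsto (fun n => Φ i (x (φ n))) atTop (𝓝 (L i)) := tendsto_pi_nhds.1 hL
  obtain ⟨x₀, hx₀, hcl⟩ := hK.exists_clusterPt (f := map (fun n => x (φ n)) atTop)
    (tendsto_principal.2 (Eventually.of_forall fun n => hx (φ n)))
  refine ⟨x₀, hx₀, φ, hφ, L, hL', fun i => le_of_forall_lt fun y hy => ?_⟩
  obtain ⟨z, hyz, hz⟩ := exists_between hy
  refine hyz.trans_le (le_of_not_gt fun hlt => ?_)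
  have h1 := (hL' i).eventually_lt_const hlt
  have h2 : ∀ᶠ y in 𝓝 x₀, y ∈ K → z < Φ i y :=
    eventually_nhdsWithin_iff.1 (hΦ i x₀ hx₀ z hz)
  have h3 : ∃ᶠ n in atTop, x (φ n) ∈ K → z < Φ i (x (φ n)) :=
    frequently_map.1 (hcl.frequently h2)
  obtain ⟨n, hn1, hn2⟩ := (h3.and_eventually h1).exists
  exact lt_asymm hn2 (hn1 (hx _))

lemma exists_tendsto_of_tendsto_coe {a : ℕ → ℝ} {L : EReal} {B : ℝ}
    (h : Tendsto (fun n => (a n : EReal)) atTop (𝓝 L)) (hB : ∀ n, |a n| ≤ B) :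
    ∃ l : ℝ, L = l ∧ Tendsto a atTop (𝓝 l) := by
  have h1 : L ≤ (B : EReal) :=
    le_of_tendsto' h fun n => EReal.coe_le_coe_iff.2 (abs_le.1 (hB n)).2
  have h2 : ((-B : ℝ) : EReal) ≤ L :=
    ge_of_tendsto' h fun n => EReal.coe_le_coe_iff.2 (abs_le.1 (hB n)).1
  lift L to ℝ using ⟨(h1.trans_lt (EReal.coe_lt_top _)).ne, ((EReal.bot_lt_coe _).trans_le h2).ne'⟩
  exact ⟨L, rfl, EReal.tendsto_coe.1 h⟩

lemma lowerSemicontinuous_coe_ereal {X : Type*} [TopologicalSpace X] {f : X → ℝ}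
    (hf : LowerSemicontinuous f) : LowerSemicontinuous fun x => (f x : EReal) :=
  continuous_coe_real_ereal.comp_lowerSemicontinuous hf
    fun _ _ h => EReal.coe_le_coe_iff.2 h

lemma lowerSemicontinuous_coe_neg {X : Type*} [TopologicalSpace X] {f : X → ℝ}
    (hf : UpperSemicontinuous f) : LowerSemicontinuous fun x => ((-f x : ℝ) : EReal) := by
  refine lowerSemicontinuous_coe_ereal fun x y hy => ?_
  filter_upwards [hf x (-y) (by linarith)] with z hz
  linarith

lemma lowerSemicontinuous_coe_slice {X : Type*} [TopologicalSpace X] {f : X × X → ℝ}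
    (hf : LowerSemicontinuous f) (y : X) : LowerSemicontinuous fun x => (f (x, y) : EReal) := by
  refine lowerSemicontinuous_coe_ereal fun x z hz => ?_
  have : Tendsto (fun x => (x, y)) (𝓝 x) (𝓝 (x, y)) :=
    (continuous_id.prodMk continuous_const).tendsto x
  exact this.eventually (hf (x, y) z hz)

/-- Convergence of the distances to a curve at rational times extends to all positive times. -/
lemma exists_tendsto_dist_of_rat {E : Type*} [MetricSpace E] {γ : ℝ → E}
    (hγ : ContinuousOn γ (Ici 0)) {x : ℕ → E} {x₀ : E}
    (hq : ∀ q : ℚ, ∃ l, Tendsto (fun n => dist (x n) (γ |(q : ℝ)|)) atTop (𝓝 l) ∧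
      dist x₀ (γ |(q : ℝ)|) ≤ l) {t : ℝ} (ht : 0 < t) :
    ∃ l, Tendsto (fun n => dist (x n) (γ t)) atTop (𝓝 l) ∧ dist x₀ (γ t) ≤ l := by
  have happ : ∀ η > 0, ∃ q : ℚ, dist (γ |(q : ℝ)|) (γ t) < η := by
    intro η hη
    have hc : ContinuousAt γ t := hγ.continuousAt (Ici_mem_nhds ht)
    obtain ⟨δ, hδ, hδ'⟩ := Metric.continuousAt_iff.1 hc η hη
    obtain ⟨q, hq1, hq2⟩ := exists_rat_btwn (show t < t + δ by linarith)
    refine ⟨q, hδ' ?_⟩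
    rw [abs_of_pos (ht.trans hq1), Real.dist_eq, abs_of_pos (by linarith)]
    linarith
  have hcl : ∀ y z w : E, |dist y z - dist y w| ≤ dist z w := fun y z w => by
    rw [dist_comm y z, dist_comm y w]
    exact abs_dist_sub_le _ _ _
  have hcauchy : CauchySeq fun n => dist (x n) (γ t) := by
    refine Metric.cauchySeq_iff'.2 fun η hη => ?_
    obtain ⟨q, hqη⟩ := happ (η / 3) (by positivity)
    obtain ⟨l, hl, -⟩ := hq q
    obtain ⟨n₀, hn₀⟩ := Metric.cauchySeq_iff'.1 hl.cauchySeq (η / 3) (by positivity)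
    refine ⟨n₀, fun n hn => ?_⟩
    have h1 := hn₀ n hn
    have h2 := hcl (x n) (γ |(q : ℝ)|) (γ t)
    have h3 := hcl (x n₀) (γ |(q : ℝ)|) (γ t)
    rw [Real.dist_eq, abs_lt] at *
    rw [abs_le] at *
    constructor <;> linarith
  obtain ⟨l, hl⟩ := cauchySeq_tendsto_of_complete hcauchy
  refine ⟨l, hl, le_of_forall_pos_le_add fun η hη => ?_⟩
  obtain ⟨q, hqη⟩ := happ (η / 2) (by positivity)
  obtain ⟨l', hl', hle⟩ := hq q
  have h1 : l' ≤ l + η / 2 := by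
    refine le_of_tendsto_of_tendsto' hl' (hl.add_const _) fun n => ?_
    have := (abs_le.1 (hcl (x n) (γ |(q : ℝ)|) (γ t))).2
    linarith
  have h2 := (abs_le.1 (hcl x₀ (γ |(q : ℝ)|) (γ t))).1
  linarith

lemma tendsto_dist_gridCeil {E : Type*} [MetricSpace E] {γ : ℝ → E}
    (hγ : ContinuousOn γ (Ici 0)) {x : ℕ → E} {t l : ℝ} (ht : 0 < t)
    (hl : Tendsto (fun n => dist (x n) (γ t)) atTop (𝓝 l))
    {N : ℕ → ℕ} (hN : Tendsto N atTop atTop) :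
    Tendsto (fun n => dist (x n) (γ (gridCeil (N n) t))) atTop (𝓝 l) := by
  have hc : ContinuousAt γ t := hγ.continuousAt (Ici_mem_nhds ht)
  have h1 : Tendsto (fun n => dist (γ (gridCeil (N n) t)) (γ t)) atTop (𝓝 0) := by
    have := (hc.tendsto.comp (tendsto_gridCeil hN ht.le)).dist
      (tendsto_const_nhds (x := γ t) (f := atTop))
    simpa using this
  have h2 : Tendsto (fun n => dist (x n) (γ (gridCeil (N n) t)) - dist (x n) (γ t))
      atTop (𝓝 0) := by
    refine squeeze_zero_norm (fun n => ?_) h1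
    rw [Real.norm_eq_abs, dist_comm (x n), dist_comm (x n)]
    exact abs_dist_sub_le _ _ _
  simpa using h2.add hl

/-- A sequence with bounded energy and bounded distance to `ρ` has a weak limit point that is
compatible, along a subsequence, with all the data entering the Hamiltonians. The continuity of `γ`
refers to the metric: the hypothesis precedes `τ`, which as a local instance would take over. -/
lemma exists_weak_limit {E : Type*} [MetricSpace E] {𝓔 : E → EReal}
    (hbot : ∀ π, 𝓔 π ≠ ⊥) {γ : ℝ → E} (hγ : ContinuousOn γ (Ici 0))
    {τ : TopologicalSpace E} (hτ : WeakTopologyAssumption 𝓔 τ)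
    {u h : E → ℝ} (hu : @UpperSemicontinuous E ℝ τ _ u) (hh : @Continuous E ℝ τ _ h)
    {Cu Ch : ℝ} (hCu : ∀ π, |u π| ≤ Cu) (hCh : ∀ π, |h π| ≤ Ch)
    {ρ : E} {R d : ℝ} {x : ℕ → E}
    (hR : ∀ n, dist ρ (x n) ≤ R) (hd : ∀ n, 𝓔 (x n) ≤ (d : EReal)) :
    ∃ (x₀ : E) (φ : ℕ → ℕ) (lu lE lρ : ℝ) (ℓ : ℝ → ℝ), StrictMono φ ∧ 𝓔 x₀ ≠ ⊤ ∧
      Tendsto (fun n => u (x (φ n))) atTop (𝓝 lu) ∧ lu ≤ u x₀ ∧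
      Tendsto (fun n => h (x (φ n))) atTop (𝓝 (h x₀)) ∧
      Tendsto (fun n => (𝓔 (x (φ n))).toReal) atTop (𝓝 lE) ∧ (𝓔 x₀).toReal ≤ lE ∧
      Tendsto (fun n => dist (x (φ n)) ρ) atTop (𝓝 lρ) ∧ dist x₀ ρ ≤ lρ ∧
      ∀ t, 0 < t → Tendsto (fun n => dist (x (φ n)) (γ t)) atTop (𝓝 (ℓ t)) ∧
        dist x₀ (γ t) ≤ ℓ t := by
  have hdist : ∀ y : E, @LowerSemicontinuous E EReal τ _ fun π => (dist π y : EReal) :=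
    fun y => @lowerSemicontinuous_coe_slice E τ _ hτ.dist_lsc y
  let Φ : ℚ ⊕ Fin 5 → E → EReal := Sum.elim (fun q π => (dist π (γ |(q : ℝ)|) : EReal))
    ![𝓔, fun π => (dist π ρ : EReal), fun π => ((-u π : ℝ) : EReal), fun π => (h π : EReal),
      fun π => ((-h π : ℝ) : EReal)]
  have hΦ : ∀ i, @LowerSemicontinuousOn E EReal τ _ (Φ i)
      {π | dist ρ π ≤ R ∧ 𝓔 π ≤ (d : EReal)} := by
    rintro (q | i)
    · exact LowerSemicontinuous.lowerSemicontinuousOn (hdist _) _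
    · fin_cases i
      · refine @LowerSemicontinuousOn.mono E EReal τ _ _ _ _ (hτ.energy_lsc ρ R) fun π hπ => ?_
        rw [Metric.mem_closedBall, dist_comm]
        exact hπ.1
      · exact LowerSemicontinuous.lowerSemicontinuousOn (hdist _) _
      · exact LowerSemicontinuous.lowerSemicontinuousOn
          (@lowerSemicontinuous_coe_neg E τ u hu) _
      · exact LowerSemicontinuous.lowerSemicontinuousOn
          (@lowerSemicontinuous_coe_ereal E τ h (hh.lowerSemicontinuous)) _
      · exact LowerSemicontinuous.lowerSemicontinuousOn
          (@lowerSemicontinuous_coe_neg E τ h (hh.upperSemicontinuous)) _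
  obtain ⟨x₀, hx₀, φ, hφ, L, hL, hle⟩ :=
    @exists_subseq_tendsto_of_isCompact E _ τ _ _ (hτ.compact ρ R d) x (fun n => ⟨hR n, hd n⟩) Φ hΦ
  have hdb : ∀ (y : E) n, |dist (x (φ n)) y| ≤ R + dist ρ y := fun y n => by
    rw [abs_of_nonneg dist_nonneg]
    have := dist_triangle (x (φ n)) ρ y
    have := hR (φ n)
    rw [dist_comm] at this
    linarith
  have hq : ∀ q : ℚ, ∃ l, Tendsto (fun n => dist (x (φ n)) (γ |(q : ℝ)|)) atTop (𝓝 l) ∧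
      dist x₀ (γ |(q : ℝ)|) ≤ l := by
    intro q
    obtain ⟨l, hl, hl'⟩ := exists_tendsto_of_tendsto_coe (hL (Sum.inl q)) (hdb _)
    have := hle (Sum.inl q)
    rw [hl] at this
    exact ⟨l, hl', EReal.coe_le_coe_iff.1 this⟩
  choose ℓ hℓ using fun (t : {t : ℝ // 0 < t}) => exists_tendsto_dist_of_rat hγ hq t.2
  have hxtop : 𝓔 x₀ ≠ ⊤ := (hx₀.2.trans_lt (EReal.coe_lt_top d)).ne
  have hE := hL (Sum.inr 0)
  have hE0 : 𝓔 x₀ ≤ L (Sum.inr 0) := hle (Sum.inr 0)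
  have hEtop : L (Sum.inr 0) ≠ ⊤ :=
    ((le_of_tendsto' hE fun n => hd (φ n)).trans_lt (EReal.coe_lt_top d)).ne
  have hEbot : L (Sum.inr 0) ≠ ⊥ := ((bot_lt_iff_ne_bot.2 (hbot x₀)).trans_le hE0).ne'
  obtain ⟨lρ, hlρ, hlρ'⟩ := exists_tendsto_of_tendsto_coe (hL (Sum.inr 1)) (hdb ρ)
  obtain ⟨lu, hlu, hlu'⟩ := exists_tendsto_of_tendsto_coe (B := Cu) (hL (Sum.inr 2))
    (fun n => by rw [abs_neg]; exact hCu _)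
  obtain ⟨lh, hlh, hlh'⟩ := exists_tendsto_of_tendsto_coe (hL (Sum.inr 3)) (fun n => hCh _)
  obtain ⟨lh2, hlh2, hlh2'⟩ := exists_tendsto_of_tendsto_coe (B := Ch) (hL (Sum.inr 4))
    (fun n => by rw [abs_neg]; exact hCh _)
  have h1 : dist x₀ ρ ≤ lρ := EReal.coe_le_coe_iff.1 (hlρ ▸ hle (Sum.inr 1))
  have h2 : -u x₀ ≤ lu := EReal.coe_le_coe_iff.1 (hlu ▸ hle (Sum.inr 2))
  have h3 : h x₀ ≤ lh := EReal.coe_le_coe_iff.1 (hlh ▸ hle (Sum.inr 3))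
  have h4 : -h x₀ ≤ lh2 := EReal.coe_le_coe_iff.1 (hlh2 ▸ hle (Sum.inr 4))
  have h5 : lh2 = -lh := tendsto_nhds_unique hlh2' hlh'.neg
  have h6 : lh = h x₀ := by linarith
  refine ⟨x₀, φ, -lu, (L (Sum.inr 0)).toReal, lρ, fun t => if ht : 0 < t then ℓ ⟨t, ht⟩ else 0,
    hφ, hxtop, ?_, by linarith, h6 ▸ hlh', (EReal.tendsto_toReal hEtop hEbot).comp hE,
    EReal.toReal_le_toReal hE0 (hbot _) hEtop, hlρ', h1, fun t ht => ?_⟩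
  · simpa using hlu'.neg
  · simp only [dif_pos ht]
    exact hℓ ⟨t, ht⟩

/-! ### The integrands as functions of time and distance -/

section Profiles

/-- `h^ε` as a function of the time and of the distance `r = d(π, μ(t))`. -/
noncomputable def hProfile (κ ε t r : ℝ) : ℝ :=
  Real.exp (kappaHat κ * t) * psi ε (1 / 2 * r ^ 2)

/-- The integrand of `Λ`. -/
noncomputable def lamProfile (κ ε : ℝ) (m : ℕ) (t r : ℝ) : ℝ :=
  Real.exp (-(m : ℝ) * hProfile κ ε t r)

/-- The integrand of `distAverage`. -/
noncomputable def distProfile (κ ε : ℝ) (m : ℕ) (t r : ℝ) : ℝ :=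
  Real.exp (-(m : ℝ) * hProfile κ ε t r) * max (1 / (m : ℝ)) (hProfile κ ε t r)

/-- The weight of the energy difference in the integrand of `energyAverage`. -/
noncomputable def energyProfile (κ ε : ℝ) (m : ℕ) (t r : ℝ) : ℝ :=
  Real.exp (-(m : ℝ) * hProfile κ ε t r) * deriv (psi ε) (1 / 2 * r ^ 2) *
    Real.exp (kappaHat κ * t)

variable {κ ε : ℝ} {m : ℕ}

lemma hProfile_nonneg (hε : 0 < ε) (t r : ℝ) : 0 ≤ hProfile κ ε t r :=
  mul_nonneg (Real.exp_pos _).le (psi_nonneg hε (by positivity))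

lemma continuous_hProfile (hε : 0 < ε) : Continuous fun p : ℝ × ℝ => hProfile κ ε p.1 p.2 := by
  have := continuous_psi hε
  unfold hProfile
  fun_prop

lemma continuous_lamProfile (hε : 0 < ε) :
    Continuous fun p : ℝ × ℝ => lamProfile κ ε m p.1 p.2 := by
  have := continuous_hProfile (κ := κ) hε
  unfold lamProfile
  fun_prop

lemma continuous_distProfile (hε : 0 < ε) :
    Continuous fun p : ℝ × ℝ => distProfile κ ε m p.1 p.2 := by
  have := continuous_hProfile (κ := κ) hε
  unfold distProfile
  fun_prop

lemma continuous_energyProfile (hε : 0 < ε) :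
    Continuous fun p : ℝ × ℝ => energyProfile κ ε m p.1 p.2 := by
  have := continuous_hProfile (κ := κ) hε
  have := continuous_psiDeriv hε
  unfold energyProfile
  rw [deriv_psi hε]
  fun_prop

lemma lamProfile_pos (t r : ℝ) : 0 < lamProfile κ ε m t r := Real.exp_pos _

lemma exp_neg_hProfile_le_one (hε : 0 < ε) (t r : ℝ) :
    Real.exp (-(m : ℝ) * hProfile κ ε t r) ≤ 1 := by
  rw [Real.exp_le_one_iff]
  have := hProfile_nonneg (κ := κ) hε t r
  have : 0 ≤ (m : ℝ) := by positivity
  nlinarith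

lemma lamProfile_le_one (hε : 0 < ε) (t r : ℝ) : lamProfile κ ε m t r ≤ 1 :=
  exp_neg_hProfile_le_one hε t r

lemma lamProfile_anti (hε : 0 < ε) (t : ℝ) {r s : ℝ} (hr : 0 ≤ r) (hrs : r ≤ s) :
    lamProfile κ ε m t s ≤ lamProfile κ ε m t r := by
  unfold lamProfile hProfile
  have h1 : psi ε (1 / 2 * r ^ 2) ≤ psi ε (1 / 2 * s ^ 2) :=
    (strictMono_psi hε).monotone (by gcongr)
  have : 0 ≤ (m : ℝ) := by positivity
  rw [Real.exp_le_exp, neg_mul, neg_mul, neg_le_neg_iff]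
  gcongr

lemma lamProfile_injOn (hε : 0 < ε) (hm : 1 ≤ m) {t r s : ℝ} (hr : 0 ≤ r) (hs : 0 ≤ s)
    (h : lamProfile κ ε m t r = lamProfile κ ε m t s) : r = s := by
  unfold lamProfile hProfile at h
  have hm' : (m : ℝ) ≠ 0 := by positivity
  have h1 := mul_left_cancel₀ (neg_ne_zero.2 hm') (Real.exp_injective h)
  have h2 := (strictMono_psi hε).injective (mul_left_cancel₀ (Real.exp_pos _).ne' h1)
  have h3 : r ^ 2 = s ^ 2 := by linarith
  exact (pow_left_inj₀ hr hs two_ne_zero).1 h3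

lemma distProfile_nonneg (t r : ℝ) : 0 ≤ distProfile κ ε m t r :=
  mul_nonneg (Real.exp_pos _).le (le_max_of_le_left (by positivity))

/-- The exponential weight compensates the growth of `h^ε`, since `x e^{-mx} ≤ 1 / m`. -/
lemma distProfile_le (hε : 0 < ε) (hm : 1 ≤ m) (t r : ℝ) :
    distProfile κ ε m t r ≤ 1 / m := by
  have hm' : (0 : ℝ) < m := by positivity
  unfold distProfile
  rw [mul_max_of_nonneg _ _ (Real.exp_pos _).le]
  refine max_le (mul_le_of_le_one_left (by positivity) (exp_neg_hProfile_le_one hε t r)) ?_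
  have h1 := Real.add_one_le_exp ((m : ℝ) * hProfile κ ε t r)
  rw [neg_mul, Real.exp_neg, inv_mul_le_iff₀ (Real.exp_pos _), mul_one_div, le_div_iff₀ hm']
  linarith

lemma energyProfile_nonneg (hε : 0 < ε) (t r : ℝ) : 0 ≤ energyProfile κ ε m t r := by
  unfold energyProfile
  rw [deriv_psi hε]
  have := psiDeriv_pos hε (1 / 2 * r ^ 2)
  positivity

lemma energyProfile_le (hε : 0 < ε) {t : ℝ} (ht : 0 ≤ t) (r : ℝ) :
    energyProfile κ ε m t r ≤ 2 / √(2 * ε) := by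
  unfold energyProfile
  rw [deriv_psi hε]
  have h1 := psiDeriv_pos hε (1 / 2 * r ^ 2)
  have h2 := psiDeriv_le hε (r := 1 / 2 * r ^ 2) (by positivity)
  have h3 := exp_neg_hProfile_le_one (κ := κ) (m := m) hε t r
  have h4 : Real.exp (kappaHat κ * t) ≤ 1 := by
    rw [Real.exp_le_one_iff]
    exact mul_nonpos_of_nonpos_of_nonneg (min_le_left _ _) ht
  calc _ ≤ 1 * psiDeriv ε (1 / 2 * r ^ 2) * 1 := by gcongr
    _ ≤ _ := by linarith

end Profiles

lemma tendsto_profile {P : ℝ → ℝ → ℝ} (hP : Continuous fun p : ℝ × ℝ => P p.1 p.2)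
    {s r : ℕ → ℝ} {t l : ℝ} (hs : Tendsto s atTop (𝓝 t)) (hr : Tendsto r atTop (𝓝 l)) :
    Tendsto (fun k => P (s k) (r k)) atTop (𝓝 (P t l)) :=
  (hP.tendsto (t, l)).comp (hs.prodMk_nhds hr)

/-- If the distances to a curve converge, so do the corresponding Riemann sums, for an integrand
which is bounded and continuous in time and distance. -/
lemma tendsto_expSum_profile {P : ℝ → ℝ → ℝ} (hP : Continuous fun p : ℝ × ℝ => P p.1 p.2)
    {C : ℝ} (hC : ∀ t r, 0 ≤ t → |P t r| ≤ C) {M : ℝ} (hM : 0 < M) {N : ℕ → ℕ}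
    (hN1 : ∀ k, 1 ≤ N k) (hN : Tendsto N atTop atTop) {D : ℕ → ℝ → ℝ} {ℓ : ℝ → ℝ}
    (hD : ∀ t, 0 < t → Tendsto (fun k => D k (gridCeil (N k) t)) atTop (𝓝 (ℓ t))) :
    Tendsto (fun k => expSum M (N k) fun t => P t (D k t)) atTop
      (𝓝 (∫ t in Ioi (0 : ℝ), Real.exp (-M * t) * P t (ℓ t))) :=
  tendsto_expSum hM hN1 hN (fun _ t ht => hC t _ ht) fun t ht =>
    tendsto_profile hP (tendsto_gridCeil hN (le_of_lt ht)) (hD t ht)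

/-- The integrands of the limiting averages are integrable. -/
lemma integrableOn_profile {P : ℝ → ℝ → ℝ} (hP : Continuous fun p : ℝ × ℝ => P p.1 p.2)
    {C : ℝ} (hC : ∀ t r, 0 ≤ t → |P t r| ≤ C) {M : ℝ} (hM : 0 < M) {ℓ : ℝ → ℝ}
    (hℓ : AEMeasurable ℓ (volume.restrict (Ioi 0))) :
    IntegrableOn (fun t => Real.exp (-M * t) * P t (ℓ t)) (Ioi 0) := by
  refine (exp_neg_integrableOn_Ioi 0 hM).mul_bdd (c := C) ?_ ?_
  · exact (hP.measurable.comp_aemeasurable (aemeasurable_id.prodMk hℓ)).aestronglyMeasurable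
  · filter_upwards [ae_restrict_mem measurableSet_Ioi] with t ht using hC t _ (le_of_lt ht)

/-! ### The averages for the two kinds of measures -/

section Averages

variable {E : Type*} [MetricSpace E] {𝓔 : E → EReal} {κ : ℝ} {S : ℝ → E → E}

lemma IsEVIGradientFlow.continuousOn (hS : IsEVIGradientFlow 𝓔 κ S) (μ : E) :
    ContinuousOn (fun t => S t μ) (Ici 0) :=
  (hS.evi μ).continuousOn

variable (ε : ℝ) (m : ℕ) (μ π : E)

lemma Lam_discrete {N : ℕ} (hN : 1 ≤ N) :
    Lam κ S (discreteExpMeasure (m + 1) N) ε m μ π = (expSum ((m + 1 : ℕ) : ℝ) N fun _ => 1)⁻¹ *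
      expSum ((m + 1 : ℕ) : ℝ) N fun t => lamProfile κ ε m t (dist π (S t μ)) :=
  integral_discreteExpMeasure _ hN _

lemma distAverage_discrete {N : ℕ} (hN : 1 ≤ N) :
    distAverage κ S (discreteExpMeasure (m + 1) N) ε m μ π =
      (Lam κ S (discreteExpMeasure (m + 1) N) ε m μ π)⁻¹ *
        ((expSum ((m + 1 : ℕ) : ℝ) N fun _ => 1)⁻¹ *
        expSum ((m + 1 : ℕ) : ℝ) N fun t => distProfile κ ε m t (dist π (S t μ))) :=
  congrArg _ (integral_discreteExpMeasure _ hN _)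

lemma energyAverage_discrete {N : ℕ} (hN : 1 ≤ N) :
    energyAverage 𝓔 κ S (discreteExpMeasure (m + 1) N) ε m μ π =
      (Lam κ S (discreteExpMeasure (m + 1) N) ε m μ π)⁻¹ *
        ((expSum ((m + 1 : ℕ) : ℝ) N fun _ => 1)⁻¹ *
          (((𝓔 μ).toReal - (𝓔 π).toReal) *
            (expSum ((m + 1 : ℕ) : ℝ) N fun t => energyProfile κ ε m t (dist π (S t μ))) -
          expSum ((m + 1 : ℕ) : ℝ) N fun t => energyProfile κ ε m t (dist π (S t μ)) *
            ((𝓔 μ).toReal - (𝓔 (S t μ)).toReal))) := by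
  refine congrArg _ ((integral_discreteExpMeasure _ hN _).trans (congrArg _ ?_))
  rw [← expSum_const_mul, ← expSum_sub]
  congr 1
  funext t
  simp only [energyProfile, hProfile, hEps, dEps]
  ring

lemma Lam_exp :
    Lam κ S (ProbabilityTheory.expMeasure ((m : ℝ) + 1)) ε m μ π = ((m + 1 : ℕ) : ℝ) *
      ∫ t in Ioi (0 : ℝ), Real.exp (-((m + 1 : ℕ) : ℝ) * t) *
        lamProfile κ ε m t (dist π (S t μ)) := by
  rw [← Nat.cast_add_one]
  exact integral_expMeasure (by positivity) _

lemma distAverage_exp :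
    distAverage κ S (ProbabilityTheory.expMeasure ((m : ℝ) + 1)) ε m μ π =
      (Lam κ S (ProbabilityTheory.expMeasure ((m : ℝ) + 1)) ε m μ π)⁻¹ * (((m + 1 : ℕ) : ℝ) *
      ∫ t in Ioi (0 : ℝ), Real.exp (-((m + 1 : ℕ) : ℝ) * t) *
        distProfile κ ε m t (dist π (S t μ))) := by
  rw [← Nat.cast_add_one]
  exact congrArg _ (integral_expMeasure (by positivity) _)

/-- The energy average for the exponential measure, split as in the discrete case. The second
integrability hypothesis is not automatic: `𝓔` may be unbounded below along the flow. -/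
lemma energyAverage_exp
    (h1 : IntegrableOn (fun t => Real.exp (-((m + 1 : ℕ) : ℝ) * t) *
      energyProfile κ ε m t (dist π (S t μ))) (Ioi 0))
    (h2 : IntegrableOn (fun t => Real.exp (-((m + 1 : ℕ) : ℝ) * t) *
      (energyProfile κ ε m t (dist π (S t μ)) * ((𝓔 μ).toReal - (𝓔 (S t μ)).toReal))) (Ioi 0)) :
    energyAverage 𝓔 κ S (ProbabilityTheory.expMeasure ((m : ℝ) + 1)) ε m μ π =
      (Lam κ S (ProbabilityTheory.expMeasure ((m : ℝ) + 1)) ε m μ π)⁻¹ * (((m + 1 : ℕ) : ℝ) *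
        (((𝓔 μ).toReal - (𝓔 π).toReal) * (∫ t in Ioi (0 : ℝ), Real.exp (-((m + 1 : ℕ) : ℝ) * t) *
            energyProfile κ ε m t (dist π (S t μ))) -
          ∫ t in Ioi (0 : ℝ), Real.exp (-((m + 1 : ℕ) : ℝ) * t) *
            (energyProfile κ ε m t (dist π (S t μ)) *
              ((𝓔 μ).toReal - (𝓔 (S t μ)).toReal)))) := by
  rw [← integral_const_mul, ← integral_sub (h1.const_mul _) h2, ← Nat.cast_add_one]
  refine congrArg _ ((integral_expMeasure (by positivity) _).trans (congrArg _ ?_))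
  congr 1
  funext t
  simp only [energyProfile, hProfile, hEps, dEps]
  ring

variable {ε m μ π}

lemma expSum_one_pos {M : ℝ} {N : ℕ} (hN : 1 ≤ N) : 0 < expSum M N fun _ => 1 :=
  expSum_pos hN fun _ _ => one_pos

lemma Lam_discrete_pos {N : ℕ} (hN : 1 ≤ N) :
    0 < Lam κ S (discreteExpMeasure (m + 1) N) ε m μ π := by
  rw [Lam_discrete _ _ _ _ hN]
  exact mul_pos (inv_pos.2 (expSum_one_pos hN)) (expSum_pos hN fun _ _ => lamProfile_pos _ _)

lemma Lam_discrete_le_one (hε : 0 < ε) {N : ℕ} (hN : 1 ≤ N) :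
    Lam κ S (discreteExpMeasure (m + 1) N) ε m μ π ≤ 1 := by
  rw [Lam_discrete _ _ _ _ hN, inv_mul_le_iff₀ (expSum_one_pos hN), mul_one]
  exact expSum_mono fun _ _ => lamProfile_le_one hε _ _

lemma distAverage_discrete_nonneg {N : ℕ} (hN : 1 ≤ N) :
    0 ≤ distAverage κ S (discreteExpMeasure (m + 1) N) ε m μ π := by
  rw [distAverage_discrete _ _ _ _ hN]
  exact mul_nonneg (inv_nonneg.2 (Lam_discrete_pos hN).le)
    (mul_nonneg (inv_nonneg.2 (expSum_one_pos hN).le)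
      (expSum_nonneg fun _ _ => distProfile_nonneg _ _))

lemma distAverage_discrete_le (hε : 0 < ε) (hm : 1 ≤ m) {N : ℕ} (hN : 1 ≤ N) :
    distAverage κ S (discreteExpMeasure (m + 1) N) ε m μ π ≤
      (Lam κ S (discreteExpMeasure (m + 1) N) ε m μ π)⁻¹ * (1 / m) := by
  rw [distAverage_discrete _ _ _ _ hN]
  refine mul_le_mul_of_nonneg_left ?_ (inv_nonneg.2 (Lam_discrete_pos hN).le)
  rw [inv_mul_le_iff₀ (expSum_one_pos hN), mul_comm, ← expSum_const_mul]
  exact expSum_mono fun _ _ => by rw [mul_one]; exact distProfile_le hε hm _ _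

lemma IsEVIGradientFlow.energy_le (hS : IsEVIGradientFlow 𝓔 κ S) (hbot : ∀ π, 𝓔 π ≠ ⊥)
    (hlsc : LowerSemicontinuous 𝓔) (hμ : 𝓔 μ ≠ ⊤) {s t : ℝ} (hs : 0 ≤ s) (hst : s ≤ t) :
    (𝓔 (S t μ)).toReal ≤ (𝓔 (S s μ)).toReal := by
  have h0 : 𝓔 (S 0 μ) ≠ ⊤ := by rwa [hS.zero]
  refine EReal.toReal_le_toReal ((hS.evi μ).energy_anti hbot hlsc h0 hs hst) (hbot _) ?_
  rcases eq_or_lt_of_le hs with h | h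
  · rwa [← h]
  · exact (hS.evi μ).mem_domain s h

lemma IsEVIGradientFlow.energyLoss_nonneg (hS : IsEVIGradientFlow 𝓔 κ S) (hbot : ∀ π, 𝓔 π ≠ ⊥)
    (hlsc : LowerSemicontinuous 𝓔) (hμ : 𝓔 μ ≠ ⊤) {t : ℝ} (ht : 0 ≤ t) :
    0 ≤ (𝓔 μ).toReal - (𝓔 (S t μ)).toReal := by
  have := hS.energy_le hbot hlsc hμ le_rfl ht
  rw [hS.zero] at this
  linarith

/-- The energy average is non-positive at points whose energy exceeds that of the starting point of
the flow. -/
lemma energyAverage_discrete_nonpos (hS : IsEVIGradientFlow 𝓔 κ S) (hbot : ∀ π, 𝓔 π ≠ ⊥)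
    (hlsc : LowerSemicontinuous 𝓔) (hμ : 𝓔 μ ≠ ⊤) (hε : 0 < ε) {N : ℕ} (hN : 1 ≤ N)
    (h : (𝓔 μ).toReal ≤ (𝓔 π).toReal) :
    energyAverage 𝓔 κ S (discreteExpMeasure (m + 1) N) ε m μ π ≤ 0 := by
  rw [energyAverage_discrete _ _ _ _ hN]
  refine mul_nonpos_of_nonneg_of_nonpos (inv_nonneg.2 (Lam_discrete_pos hN).le)
    (mul_nonpos_of_nonneg_of_nonpos (inv_nonneg.2 (expSum_one_pos hN).le) ?_)
  have h1 : 0 ≤ expSum ((m + 1 : ℕ) : ℝ) N fun t => energyProfile κ ε m t (dist π (S t μ)) :=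
    expSum_nonneg fun _ _ => energyProfile_nonneg hε _ _
  have h2 : 0 ≤ expSum ((m + 1 : ℕ) : ℝ) N fun t => energyProfile κ ε m t (dist π (S t μ)) *
            ((𝓔 μ).toReal - (𝓔 (S t μ)).toReal) :=
    expSum_nonneg fun _ ht => mul_nonneg (energyProfile_nonneg hε _ _)
      (hS.energyLoss_nonneg hbot hlsc hμ ht)
  nlinarith

lemma abs_lamProfile_le (hε : 0 < ε) (t r : ℝ) (_ : 0 ≤ t) : |lamProfile κ ε m t r| ≤ 1 := by
  rw [abs_of_pos (lamProfile_pos _ _)]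
  exact lamProfile_le_one hε t r

lemma abs_distProfile_le (hε : 0 < ε) (hm : 1 ≤ m) (t r : ℝ) (_ : 0 ≤ t) :
    |distProfile κ ε m t r| ≤ 1 / m := by
  rw [abs_of_nonneg (distProfile_nonneg _ _)]
  exact distProfile_le hε hm t r

lemma abs_energyProfile_le (hε : 0 < ε) (t r : ℝ) (ht : 0 ≤ t) :
    |energyProfile κ ε m t r| ≤ 2 / √(2 * ε) := by
  rw [abs_of_nonneg (energyProfile_nonneg hε _ _)]
  exact energyProfile_le hε ht r

lemma aemeasurable_dist_flow (hS : IsEVIGradientFlow 𝓔 κ S) :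
    AEMeasurable (fun t => dist π (S t μ)) (volume.restrict (Ioi 0)) := by
  have : ContinuousOn (fun t => dist π (S t μ)) (Ioi 0) :=
    continuous_dist.comp_continuousOn
      (continuousOn_const.prodMk ((hS.continuousOn μ).mono Ioi_subset_Ici_self))
  exact this.aemeasurable measurableSet_Ioi

lemma integral_exp_mul_lamProfile_pos (hε : 0 < ε) {ℓ : ℝ → ℝ}
    (hℓ : AEMeasurable ℓ (volume.restrict (Ioi 0))) :
    0 < ∫ t in Ioi (0 : ℝ), Real.exp (-((m + 1 : ℕ) : ℝ) * t) * lamProfile κ ε m t (ℓ t) := by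
  rw [integral_pos_iff_support_of_nonneg]
  · have : (Function.support fun t => Real.exp (-((m + 1 : ℕ) : ℝ) * t) *
        lamProfile κ ε m t (ℓ t)) = univ :=
      eq_univ_of_forall fun t => (mul_pos (Real.exp_pos _) (lamProfile_pos _ _)).ne'
    rw [this]
    simp
  · exact fun t => (mul_pos (Real.exp_pos _) (lamProfile_pos _ _)).le
  · exact integrableOn_profile (continuous_lamProfile hε) (abs_lamProfile_le hε)
      (by positivity) hℓ

lemma Lam_exp_pos (hS : IsEVIGradientFlow 𝓔 κ S) (hε : 0 < ε) :
    0 < Lam κ S (ProbabilityTheory.expMeasure ((m : ℝ) + 1)) ε m μ π := by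
  rw [Lam_exp]
  exact mul_pos (by positivity) (integral_exp_mul_lamProfile_pos hε (aemeasurable_dist_flow hS))

lemma tendsto_Lam_discrete (hε : 0 < ε) {N : ℕ → ℕ} (hN1 : ∀ k, 1 ≤ N k)
    (hN : Tendsto N atTop atTop) {x : ℕ → E} {ℓ : ℝ → ℝ}
    (hℓ : ∀ t, 0 < t → Tendsto (fun k => dist (x k) (S (gridCeil (N k) t) μ)) atTop (𝓝 (ℓ t))) :
    Tendsto (fun k => Lam κ S (discreteExpMeasure (m + 1) (N k)) ε m μ (x k)) atTop
      (𝓝 (((m + 1 : ℕ) : ℝ) * ∫ t in Ioi (0 : ℝ), Real.exp (-((m + 1 : ℕ) : ℝ) * t) *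
        lamProfile κ ε m t (ℓ t))) := by
  have hM : (0 : ℝ) < ((m + 1 : ℕ) : ℝ) := by positivity
  simp only [fun k => Lam_discrete (κ := κ) (S := S) ε m μ (x k) (hN1 k)]
  exact (tendsto_expSum_one hM hN1 hN).mul (tendsto_expSum_profile (continuous_lamProfile hε)
    (abs_lamProfile_le hε) hM hN1 hN hℓ)

/-- Pointwise convergence of the test functions. -/
lemma tendsto_fDag_discrete (hS : IsEVIGradientFlow 𝓔 κ S) (hε : 0 < ε) {N : ℕ → ℕ}
    (hN1 : ∀ k, 1 ≤ N k) (hN : Tendsto N atTop atTop) (a b c : ℝ) (ρ μ π : E) :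
    Tendsto (fun k => fDag κ S (discreteExpMeasure (m + 1) (N k)) a b c ε m ρ μ π) atTop
      (𝓝 (fDag κ S (ProbabilityTheory.expMeasure ((m : ℝ) + 1)) a b c ε m ρ μ π)) := by
  have h1 := tendsto_Lam_discrete (κ := κ) (S := S) (μ := μ) (m := m) hε hN1 hN (x := fun _ => π)
    (ℓ := fun t => dist π (S t μ)) fun t ht =>
      tendsto_dist_gridCeil (hS.continuousOn μ) ht tendsto_const_nhds hN
  rw [← Lam_exp] at h1
  exact ((((h1.log (Lam_exp_pos hS hε).ne').const_mul _).const_mul _).const_add _).add_const _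

end Averages

/-! ### Limits of almost optimal points -/

section Limits

variable {E : Type*} [MetricSpace E] {𝓔 : E → EReal} {κ : ℝ} {S : ℝ → E → E}

/-- The finite part of the Hamiltonians `g†` and `-g‡`, which differ only in the coefficient `θ` of
the squared distance: `θ = a² / 2` for `g†` and `θ = -a² / 2` for `-g‡`. -/
noncomputable def realHam (𝓔 : E → EReal) (κ : ℝ) (S : ℝ → E → E) (ν : Measure ℝ)
    (a b θ ε : ℝ) (m : ℕ) (ρ μ π : E) : ℝ :=
  a * ((𝓔 ρ).toReal - (𝓔 π).toReal) - a * (κ / 2) * dist π ρ ^ 2 + θ * dist π ρ ^ 2 +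
    a * b * dist π ρ + b ^ 2 / 2 + b * energyAverage 𝓔 κ S ν ε m μ π -
    b * (kappaHat κ / 2) * distAverage κ S ν ε m μ π

/-- A bound on the test function bounds the distance to `ρ`, and `Λ` away from zero. -/
lemma bounds_of_fDag_le {a b c ε K : ℝ} {m N : ℕ} {ρ μ π : E} (ha : 0 < a) (hb : 0 < b)
    (hε : 0 < ε) (hm : 1 ≤ m) (hN : 1 ≤ N)
    (h : fDag κ S (discreteExpMeasure (m + 1) N) a b c ε m ρ μ π ≤ K) :
    dist π ρ ≤ √(2 * (K - c) / a) ∧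
      Real.exp (-(m * (K - c) / b)) ≤ Lam κ S (discreteExpMeasure (m + 1) N) ε m μ π := by
  have hm' : (0 : ℝ) < m := by positivity
  have h0 := Lam_discrete_pos (κ := κ) (S := S) (ε := ε) (m := m) (μ := μ) (π := π) hN
  have h1 := Lam_discrete_le_one (κ := κ) (S := S) (m := m) (μ := μ) (π := π) hε hN
  have hlog := Real.log_nonpos h0.le h1
  unfold fDag at h
  have hL : 0 ≤ b * (-(1 / (m : ℝ)) *
      Real.log (Lam κ S (discreteExpMeasure (m + 1) N) ε m μ π)) :=
    mul_nonneg hb.le (mul_nonneg_of_nonpos_of_nonpos (by simp) hlog)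
  have hd : 0 ≤ 1 / 2 * a * dist π ρ ^ 2 := by positivity
  constructor
  · apply Real.le_sqrt_of_sq_le
    rw [le_div_iff₀ ha]
    linarith
  · rw [← Real.le_log_iff_exp_le h0]
    have h2 : b * (-(1 / (m : ℝ)) *
        Real.log (Lam κ S (discreteExpMeasure (m + 1) N) ε m μ π)) ≤ K - c := by linarith
    have h3 : b * (-(1 / (m : ℝ)) * Real.log (Lam κ S (discreteExpMeasure (m + 1) N) ε m μ π))
        = -(b / m * Real.log (Lam κ S (discreteExpMeasure (m + 1) N) ε m μ π)) := by ring
    rw [h3, neg_le, ← div_le_iff₀' (by positivity)] at h2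
    refine le_of_eq_of_le ?_ h2
    field_simp

/-- A lower bound on the Hamiltonian bounds the energy. -/
lemma energy_le_of_le_realHam (hS : IsEVIGradientFlow 𝓔 κ S) (hbot : ∀ π, 𝓔 π ≠ ⊥)
    (hlsc : LowerSemicontinuous 𝓔) {a b θ ε R l K : ℝ} {m N : ℕ} {ρ μ π : E} (hμ : 𝓔 μ ≠ ⊤)
    (ha : 0 < a) (hb : 0 < b) (hε : 0 < ε) (hm : 1 ≤ m) (hN : 1 ≤ N)
    (hR : dist π ρ ≤ R) (hl : 0 < l)
    (hΛ : l ≤ Lam κ S (discreteExpMeasure (m + 1) N) ε m μ π)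
    (h : K ≤ realHam 𝓔 κ S (discreteExpMeasure (m + 1) N) a b θ ε m ρ μ π) :
    (𝓔 π).toReal ≤ max (𝓔 μ).toReal (((𝓔 ρ).toReal * a + (a * |κ / 2| + |θ|) * R ^ 2 + a * b * R +
      b ^ 2 / 2 + b * |kappaHat κ / 2| * (l⁻¹ * (1 / m)) - K) / a) := by
  rcases le_total (𝓔 π).toReal (𝓔 μ).toReal with h1 | h1
  · exact le_max_of_le_left h1
  refine le_max_of_le_right ?_
  rw [le_div_iff₀ ha]
  have hA := energyAverage_discrete_nonpos (m := m) hS hbot hlsc hμ hε hN h1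
  have hD0 := distAverage_discrete_nonneg (κ := κ) (S := S) (ε := ε) (m := m) (μ := μ) (π := π) hN
  have hD : distAverage κ S (discreteExpMeasure (m + 1) N) ε m μ π ≤ l⁻¹ * (1 / m) :=
    (distAverage_discrete_le hε hm hN).trans (by gcongr)
  unfold realHam at h
  have hd : dist π ρ ^ 2 ≤ R ^ 2 := by gcongr
  have t1 : -(a * (κ / 2) * dist π ρ ^ 2) ≤ a * |κ / 2| * R ^ 2 := by
    have : -(κ / 2) ≤ |κ / 2| := neg_le_abs _
    calc -(a * (κ / 2) * dist π ρ ^ 2) = a * (-(κ / 2)) * dist π ρ ^ 2 := by ring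
      _ ≤ a * |κ / 2| * dist π ρ ^ 2 := by gcongr
      _ ≤ _ := by gcongr
  have t2 : θ * dist π ρ ^ 2 ≤ |θ| * R ^ 2 := by
    calc θ * dist π ρ ^ 2 ≤ |θ| * dist π ρ ^ 2 := by gcongr; exact le_abs_self _
      _ ≤ _ := by gcongr
  have t3 : a * b * dist π ρ ≤ a * b * R := by gcongr
  have t4 : -(b * (kappaHat κ / 2) * distAverage κ S (discreteExpMeasure (m + 1) N) ε m μ π) ≤
      b * |kappaHat κ / 2| * (l⁻¹ * (1 / m)) := by
    calc _ = b * (-(kappaHat κ / 2)) *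
          distAverage κ S (discreteExpMeasure (m + 1) N) ε m μ π := by ring
      _ ≤ b * |kappaHat κ / 2| * distAverage κ S (discreteExpMeasure (m + 1) N) ε m μ π := by
        gcongr; exact neg_le_abs _
      _ ≤ _ := by gcongr
  have t5 := mul_nonpos_of_nonneg_of_nonpos hb.le hA
  linarith

/-- Comparison at the limit point. If the limits of the distances dominate the distances of the
limit point, and the limiting value of `u - f` is not less than its value at the limit point, then
no mass is lost: all limits are attained. -/
lemma limits_attained (hS : IsEVIGradientFlow 𝓔 κ S) {a b c ε : ℝ} {m : ℕ} {ρ μ x₀ : E}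
    (ha : 0 < a) (hb : 0 < b) (hε : 0 < ε) (hm : 1 ≤ m) {u₀ lu lρ : ℝ} {ℓ : ℝ → ℝ}
    (hu : lu ≤ u₀) (hρ : dist x₀ ρ ≤ lρ) (hℓm : AEMeasurable ℓ (volume.restrict (Ioi 0)))
    (hℓ : ∀ t, 0 < t → dist x₀ (S t μ) ≤ ℓ t)
    (h : u₀ - fDag κ S (ProbabilityTheory.expMeasure ((m : ℝ) + 1)) a b c ε m ρ μ x₀ ≤
      lu - (1 / 2 * a * lρ ^ 2 + b * (-(1 / (m : ℝ)) * Real.log (((m + 1 : ℕ) : ℝ) *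
        ∫ t in Ioi (0 : ℝ), Real.exp (-((m + 1 : ℕ) : ℝ) * t) * lamProfile κ ε m t (ℓ t))) + c)) :
    lu = u₀ ∧ lρ = dist x₀ ρ ∧
      ∀ᵐ t ∂(volume.restrict (Ioi (0 : ℝ))), ℓ t = dist x₀ (S t μ) := by
  have hM : (0 : ℝ) < ((m + 1 : ℕ) : ℝ) := by positivity
  have hm' : (0 : ℝ) < m := by positivity
  have hI1 := integrableOn_profile (M := ((m + 1 : ℕ) : ℝ))
    (continuous_lamProfile (κ := κ) (m := m) hε) (abs_lamProfile_le hε) hM hℓm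
  have hI2 := integrableOn_profile (M := ((m + 1 : ℕ) : ℝ))
    (continuous_lamProfile (κ := κ) (m := m) hε) (abs_lamProfile_le hε) hM
    (aemeasurable_dist_flow (μ := μ) (π := x₀) hS)
  have hp1 := integral_exp_mul_lamProfile_pos (κ := κ) (m := m) hε hℓm
  have hle : (fun t => Real.exp (-((m + 1 : ℕ) : ℝ) * t) * lamProfile κ ε m t (ℓ t))
      ≤ᵐ[volume.restrict (Ioi (0 : ℝ))]
      fun t => Real.exp (-((m + 1 : ℕ) : ℝ) * t) * lamProfile κ ε m t (dist x₀ (S t μ)) := by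
    filter_upwards [ae_restrict_mem measurableSet_Ioi] with t ht
    exact mul_le_mul_of_nonneg_left (lamProfile_anti hε t dist_nonneg (hℓ t ht)) (Real.exp_pos _).le
  have hint := integral_mono_ae hI1 hI2 hle
  rw [fDag, Lam_exp] at h
  set I1 := ∫ t in Ioi (0 : ℝ), Real.exp (-((m + 1 : ℕ) : ℝ) * t) * lamProfile κ ε m t (ℓ t)
    with hI1def
  set I2 := ∫ t in Ioi (0 : ℝ), Real.exp (-((m + 1 : ℕ) : ℝ) * t) *
    lamProfile κ ε m t (dist x₀ (S t μ)) with hI2def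
  have hlog : Real.log (((m + 1 : ℕ) : ℝ) * I1) ≤ Real.log (((m + 1 : ℕ) : ℝ) * I2) :=
    Real.log_le_log (mul_pos hM hp1) (mul_le_mul_of_nonneg_left hint hM.le)
  have hsq : 1 / 2 * a * dist x₀ ρ ^ 2 ≤ 1 / 2 * a * lρ ^ 2 := by gcongr
  have hbl : b * (-(1 / (m : ℝ)) * Real.log (((m + 1 : ℕ) : ℝ) * I2)) ≤
      b * (-(1 / (m : ℝ)) * Real.log (((m + 1 : ℕ) : ℝ) * I1)) := by
    rw [neg_mul, neg_mul]
    gcongr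
  refine ⟨by linarith, ?_, ?_⟩
  · have h1 : 1 / 2 * a * dist x₀ ρ ^ 2 = 1 / 2 * a * lρ ^ 2 := by linarith
    have h2 := mul_left_cancel₀ (by positivity) h1
    exact ((pow_left_inj₀ dist_nonneg (dist_nonneg.trans hρ) two_ne_zero).1 h2).symm
  · have h1 : b * (-(1 / (m : ℝ)) * Real.log (((m + 1 : ℕ) : ℝ) * I2)) =
      b * (-(1 / (m : ℝ)) * Real.log (((m + 1 : ℕ) : ℝ) * I1)) := by linarith
    have h2 := mul_left_cancel₀ (neg_ne_zero.2 (one_div_pos.2 hm').ne') (mul_left_cancel₀ hb.ne' h1)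
    have h3 := Real.log_injOn_pos (mul_pos hM (hp1.trans_le hint)) (mul_pos hM hp1) h2
    have h4 : I1 = I2 := (mul_left_cancel₀ hM.ne' h3).symm
    filter_upwards [(integral_eq_iff_of_ae_le hI1 hI2 hle).1 h4,
      ae_restrict_mem measurableSet_Ioi] with t ht ht0
    exact lamProfile_injOn hε hm (dist_nonneg.trans (hℓ t ht0)) dist_nonneg
      (mul_left_cancel₀ (Real.exp_pos _).ne' ht)

/-- Passage to the limit in the Hamiltonian inequality, along points whose data converge to those
of `x₀`. Only the energy at `x₀` and the energies along the flow are merely controlled from one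
side, by lower semi-continuity and by Fatou's lemma; both enter with the favourable sign. -/
lemma realHam_limit (hS : IsEVIGradientFlow 𝓔 κ S) (hbot : ∀ π, 𝓔 π ≠ ⊥)
    (hlsc : LowerSemicontinuous 𝓔) {a b θ ε lam : ℝ} {m : ℕ} {ρ μ x₀ : E} (hμ : 𝓔 μ ≠ ⊤)
    (ha : 0 < a) (hb : 0 < b) (hε : 0 < ε) (hm : 1 ≤ m) (hlam : 0 < lam)
    {N : ℕ → ℕ} (hN1 : ∀ k, 1 ≤ N k) (hN : Tendsto N atTop atTop) {x : ℕ → E}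
    {w : ℕ → ℝ} {w₀ lE : ℝ} {ℓ : ℝ → ℝ} (hw : Tendsto w atTop (𝓝 w₀))
    (hE : Tendsto (fun k => (𝓔 (x k)).toReal) atTop (𝓝 lE)) (hE0 : (𝓔 x₀).toReal ≤ lE)
    (hρ : Tendsto (fun k => dist (x k) ρ) atTop (𝓝 (dist x₀ ρ)))
    (hℓ : ∀ t, 0 < t → Tendsto (fun k => dist (x k) (S (gridCeil (N k) t) μ)) atTop (𝓝 (ℓ t)))
    (hℓeq : ∀ᵐ t ∂(volume.restrict (Ioi (0 : ℝ))), ℓ t = dist x₀ (S t μ))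
    (h : ∀ k, w k ≤ lam * realHam 𝓔 κ S (discreteExpMeasure (m + 1) (N k)) a b θ ε m ρ μ (x k)) :
    w₀ ≤ lam * realHam 𝓔 κ S (ProbabilityTheory.expMeasure ((m : ℝ) + 1)) a b θ ε m ρ μ x₀ := by
  have hM : (0 : ℝ) < ((m + 1 : ℕ) : ℝ) := by positivity
  have hcongr : ∀ P : ℝ → ℝ → ℝ,
      (fun t => Real.exp (-((m + 1 : ℕ) : ℝ) * t) * P t (ℓ t)) =ᵐ[volume.restrict (Ioi (0 : ℝ))]
      fun t => Real.exp (-((m + 1 : ℕ) : ℝ) * t) * P t (dist x₀ (S t μ)) := by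
    intro P
    filter_upwards [hℓeq] with t ht
    rw [ht]
  have hZ := tendsto_expSum_one hM hN1 hN
  have hΛ := tendsto_Lam_discrete (κ := κ) (S := S) (m := m) hε hN1 hN hℓ
  rw [integral_congr_ae (hcongr (lamProfile κ ε m)), ← Lam_exp] at hΛ
  have hΛpos := Lam_exp_pos (m := m) (μ := μ) (π := x₀) hS hε
  have hΛkpos := fun k =>
    Lam_discrete_pos (κ := κ) (S := S) (ε := ε) (m := m) (μ := μ) (π := x k) (hN1 k)
  have hD := tendsto_expSum_profile (continuous_distProfile (κ := κ) (m := m) hε)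
    (abs_distProfile_le hε hm) hM hN1 hN (D := fun k t => dist (x k) (S t μ)) hℓ
  have hP := tendsto_expSum_profile (continuous_energyProfile (κ := κ) (m := m) hε)
    (abs_energyProfile_le hε) hM hN1 hN (D := fun k t => dist (x k) (S t μ)) hℓ
  rw [integral_congr_ae (hcongr (distProfile κ ε m))] at hD
  rw [integral_congr_ae (hcongr (energyProfile κ ε m))] at hP
  have hDA : Tendsto
      (fun k => distAverage κ S (discreteExpMeasure (m + 1) (N k)) ε m μ (x k)) atTop
      (𝓝 (distAverage κ S (ProbabilityTheory.expMeasure ((m : ℝ) + 1)) ε m μ x₀)) := by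
    simp only [fun k => distAverage_discrete (κ := κ) (S := S) ε m μ (x k) (hN1 k)]
    rw [distAverage_exp]
    exact (hΛ.inv₀ hΛpos.ne').mul (hZ.mul hD)
  -- everything in the inequality except the energy loss along the flow
  let A : ℕ → ℝ := fun k => a * ((𝓔 ρ).toReal - (𝓔 (x k)).toReal) -
    a * (κ / 2) * dist (x k) ρ ^ 2 + θ * dist (x k) ρ ^ 2 + a * b * dist (x k) ρ + b ^ 2 / 2 +
    b * ((Lam κ S (discreteExpMeasure (m + 1) (N k)) ε m μ (x k))⁻¹ *
      ((expSum ((m + 1 : ℕ) : ℝ) (N k) fun _ => 1)⁻¹ * (((𝓔 μ).toReal - (𝓔 (x k)).toReal) *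
      expSum ((m + 1 : ℕ) : ℝ) (N k) fun t => energyProfile κ ε m t (dist (x k) (S t μ))))) -
    b * (kappaHat κ / 2) * distAverage κ S (discreteExpMeasure (m + 1) (N k)) ε m μ (x k)
  have hA : Tendsto A atTop (𝓝 (a * ((𝓔 ρ).toReal - lE) -
    a * (κ / 2) * dist x₀ ρ ^ 2 + θ * dist x₀ ρ ^ 2 + a * b * dist x₀ ρ + b ^ 2 / 2 +
    b * ((Lam κ S (ProbabilityTheory.expMeasure ((m : ℝ) + 1)) ε m μ x₀)⁻¹ *
      (((m + 1 : ℕ) : ℝ) * (((𝓔 μ).toReal - lE) *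
      ∫ t in Ioi (0 : ℝ), Real.exp (-((m + 1 : ℕ) : ℝ) * t) *
        energyProfile κ ε m t (dist x₀ (S t μ))))) -
    b * (kappaHat κ / 2) *
      distAverage κ S (ProbabilityTheory.expMeasure ((m : ℝ) + 1)) ε m μ x₀)) := by
    have t1 := (hE.const_sub (𝓔 ρ).toReal).const_mul a
    have t2 := (hρ.pow 2).const_mul (a * (κ / 2))
    have t3 := (hρ.pow 2).const_mul θ
    have t4 := hρ.const_mul (a * b)
    have t5 := ((hΛ.inv₀ hΛpos.ne').mul
      (hZ.mul ((hE.const_sub (𝓔 μ).toReal).mul hP))).const_mul b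
    have t6 := hDA.const_mul (b * (kappaHat κ / 2))
    exact (((((t1.sub t2).add t3).add t4).add_const (b ^ 2 / 2)).add t5).sub t6
  have hbΛ : Tendsto (fun k => b * (Lam κ S (discreteExpMeasure (m + 1) (N k)) ε m μ (x k))⁻¹ *
      (expSum ((m + 1 : ℕ) : ℝ) (N k) fun _ => 1)⁻¹) atTop
      (𝓝 (b * (Lam κ S (ProbabilityTheory.expMeasure ((m : ℝ) + 1)) ε m μ x₀)⁻¹ *
        ((m + 1 : ℕ) : ℝ))) :=
    ((hΛ.inv₀ hΛpos.ne').const_mul b).mul hZ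
  have hbpos : 0 < b * (Lam κ S (ProbabilityTheory.expMeasure ((m : ℝ) + 1)) ε m μ x₀)⁻¹ *
        ((m + 1 : ℕ) : ℝ) := by positivity
  have hmon : MonotoneOn (fun t => (𝓔 μ).toReal - (𝓔 (S t μ)).toReal) (Ioi 0) :=
    fun s hs t _ hst => sub_le_sub_left (hS.energy_le hbot hlsc hμ (le_of_lt hs) hst) _
  have hglim : ∀ t, 0 < t → Tendsto
      (fun k => energyProfile κ ε m (gridCeil (N k) t) (dist (x k) (S (gridCeil (N k) t) μ))) atTop
      (𝓝 (energyProfile κ ε m t (ℓ t))) := fun t ht =>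
    tendsto_profile (continuous_energyProfile hε) (tendsto_gridCeil hN ht.le) (hℓ t ht)
  have hRk : ∀ k, expSum ((m + 1 : ℕ) : ℝ) (N k) (fun t =>
      energyProfile κ ε m t (dist (x k) (S t μ)) * ((𝓔 μ).toReal - (𝓔 (S t μ)).toReal)) ≤
      (A k - w k / lam) / (b * (Lam κ S (discreteExpMeasure (m + 1) (N k)) ε m μ (x k))⁻¹ *
      (expSum ((m + 1 : ℕ) : ℝ) (N k) fun _ => 1)⁻¹) := by
    intro k
    have hpos : 0 < b * (Lam κ S (discreteExpMeasure (m + 1) (N k)) ε m μ (x k))⁻¹ *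
        (expSum ((m + 1 : ℕ) : ℝ) (N k) fun _ => 1)⁻¹ :=
      mul_pos (mul_pos hb (inv_pos.2 (hΛkpos k))) (inv_pos.2 (expSum_one_pos (hN1 k)))
    rw [le_div_iff₀ hpos]
    have hk := h k
    rw [← div_le_iff₀' hlam, realHam, energyAverage_discrete _ _ _ _ (hN1 k)] at hk
    simp only [A]
    linarith
  have hRlim := (hA.sub (hw.div_const lam)).div hbΛ hbpos.ne'
  obtain ⟨hQint, hQ⟩ := integral_le_of_expSum_le hN1 hN
    (g := fun k t => energyProfile κ ε m t (dist (x k) (S t μ)))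
    (fun k t _ => energyProfile_nonneg hε _ _) hmon
    (fun t ht => hS.energyLoss_nonneg hbot hlsc hμ ht.le) hglim hRk hRlim
  have hcongr' := hcongr fun t r => energyProfile κ ε m t r *
    ((𝓔 μ).toReal - (𝓔 (S t μ)).toReal)
  rw [integral_congr_ae hcongr', le_div_iff₀ hbpos] at hQ
  have hQint' := hQint.congr hcongr'
  have hPint := integrableOn_profile (M := ((m + 1 : ℕ) : ℝ))
    (continuous_energyProfile (κ := κ) (m := m) hε)
    (abs_energyProfile_le hε) hM (aemeasurable_dist_flow (μ := μ) (π := x₀) hS)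
  have hPnn : 0 ≤ ∫ t in Ioi (0 : ℝ), Real.exp (-((m + 1 : ℕ) : ℝ) * t) *
      energyProfile κ ε m t (dist x₀ (S t μ)) :=
    integral_nonneg fun t => mul_nonneg (Real.exp_pos _).le (energyProfile_nonneg hε _ _)
  rw [← div_le_iff₀' hlam, realHam, energyAverage_exp _ _ _ _ hPint hQint']
  have hmono : b * ((Lam κ S (ProbabilityTheory.expMeasure ((m : ℝ) + 1)) ε m μ x₀)⁻¹ *
      (((m + 1 : ℕ) : ℝ) * (((𝓔 μ).toReal - lE) *
      ∫ t in Ioi (0 : ℝ), Real.exp (-((m + 1 : ℕ) : ℝ) * t) *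
        energyProfile κ ε m t (dist x₀ (S t μ))))) ≤
      b * ((Lam κ S (ProbabilityTheory.expMeasure ((m : ℝ) + 1)) ε m μ x₀)⁻¹ *
      (((m + 1 : ℕ) : ℝ) * (((𝓔 μ).toReal - (𝓔 x₀).toReal) *
      ∫ t in Ioi (0 : ℝ), Real.exp (-((m + 1 : ℕ) : ℝ) * t) *
        energyProfile κ ε m t (dist x₀ (S t μ))))) := by
    gcongr
  have hmono2 : a * ((𝓔 ρ).toReal - lE) ≤ a * ((𝓔 ρ).toReal - (𝓔 x₀).toReal) := by gcongr
  linarith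

end Limits

/-! ### Optimal points for the exact integrals -/

section Optimal

variable {E : Type*} [MetricSpace E] {𝓔 : E → EReal} {κ : ℝ} {S : ℝ → E → E}

/-- Almost optimal points for the Riemann sums have a weak limit point which is optimal for the
exact integral and satisfies the limiting Hamiltonian inequality. -/
lemma exists_optimal (hS : IsEVIGradientFlow 𝓔 κ S) (hbot : ∀ π, 𝓔 π ≠ ⊥)
    (hlsc : LowerSemicontinuous 𝓔) {a b c θ ε lam : ℝ} {m : ℕ} {ρ μ : E} (hμ : 𝓔 μ ≠ ⊤)
    (ha : 0 < a) (hb : 0 < b) (hε : 0 < ε) (hm : 1 ≤ m) (hlam : 0 < lam)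
    {τ : TopologicalSpace E} (hτ : WeakTopologyAssumption 𝓔 τ)
    {u h : E → ℝ} (hu : @UpperSemicontinuous E ℝ τ _ u) (hh : @Continuous E ℝ τ _ h)
    {Cu Ch : ℝ} (hCu : ∀ π, |u π| ≤ Cu) (hCh : ∀ π, |h π| ≤ Ch)
    (H : ∀ n : ℕ, 1 ≤ n → ∀ δ > 0, ∃ x, 𝓔 x ≠ ⊤ ∧
      (∀ y, u y - fDag κ S (discreteExpMeasure (m + 1) n) a b c ε m ρ μ y ≤
        u x - fDag κ S (discreteExpMeasure (m + 1) n) a b c ε m ρ μ x + δ) ∧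
      u x - lam * realHam 𝓔 κ S (discreteExpMeasure (m + 1) n) a b θ ε m ρ μ x - h x ≤ δ) :
    ∃ x, 𝓔 x ≠ ⊤ ∧
      (∀ y, u y - fDag κ S (ProbabilityTheory.expMeasure ((m : ℝ) + 1)) a b c ε m ρ μ y ≤
        u x - fDag κ S (ProbabilityTheory.expMeasure ((m : ℝ) + 1)) a b c ε m ρ μ x) ∧
      u x - lam * realHam 𝓔 κ S (ProbabilityTheory.expMeasure ((m : ℝ) + 1)) a b θ ε m ρ μ x
        - h x ≤ 0 := by
  have hM : (0 : ℝ) < ((m + 1 : ℕ) : ℝ) := by positivity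
  choose x hxtop hxopt hxham using fun n : ℕ =>
    H (n + 1) (by omega) (1 / ((n : ℝ) + 1)) (by positivity)
  have hδ1 : ∀ n : ℕ, 1 / ((n : ℝ) + 1) ≤ 1 := fun n => by
    rw [div_le_one (by positivity)]
    have : (0 : ℝ) ≤ n := by positivity
    linarith
  have hF : ∀ {N : ℕ → ℕ}, (∀ k, 1 ≤ N k) → Tendsto N atTop atTop → ∀ y, Tendsto
      (fun k => fDag κ S (discreteExpMeasure (m + 1) (N k)) a b c ε m ρ μ y) atTop
      (𝓝 (fDag κ S (ProbabilityTheory.expMeasure ((m : ℝ) + 1)) a b c ε m ρ μ y)) :=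
    fun h1 h2 y => tendsto_fDag_discrete hS hε h1 h2 a b c ρ μ y
  -- comparison with `ρ`, where the test functions converge, bounds `f` along the sequence
  obtain ⟨B, hB⟩ := (hF (N := fun n => n + 1) (fun n => by omega)
    (tendsto_add_atTop_nat 1) ρ).bddAbove_range
  have hK : ∀ n : ℕ, fDag κ S (discreteExpMeasure (m + 1) (n + 1)) a b c ε m ρ μ (x n) ≤
      2 * Cu + 1 + B := by
    intro n
    have h1 := hxopt n ρ
    have h2 : fDag κ S (discreteExpMeasure (m + 1) (n + 1)) a b c ε m ρ μ ρ ≤ B :=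
      hB (mem_range_self n)
    have h3 := (abs_le.1 (hCu ρ)).1
    have h4 := (abs_le.1 (hCu (x n))).2
    have h5 := hδ1 n
    linarith
  have hbd := fun n => bounds_of_fDag_le ha hb hε hm (by omega : 1 ≤ n + 1) (hK n)
  have hHam : ∀ n, -(Cu + Ch + 1) / lam ≤
      realHam 𝓔 κ S (discreteExpMeasure (m + 1) (n + 1)) a b θ ε m ρ μ (x n) := by
    intro n
    rw [div_le_iff₀' hlam]
    have h1 := hxham n
    have h2 := (abs_le.1 (hCu (x n))).1
    have h3 := (abs_le.1 (hCh (x n))).2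
    have h4 := hδ1 n
    linarith
  have hE := fun n => energy_le_of_le_realHam hS hbot hlsc hμ ha hb hε hm
    (by omega : 1 ≤ n + 1) (hbd n).1 (Real.exp_pos _) (hbd n).2 (hHam n)
  have hE' : ∀ n, 𝓔 (x n) ≤ ((_ : ℝ) : EReal) := fun n =>
    (EReal.coe_toReal (hxtop n) (hbot _)).symm.le.trans (EReal.coe_le_coe_iff.2 (hE n))
  obtain ⟨x₀, φ, lu, lE, lρ, ℓ, hφ, hx₀, hlu, hlu0, hlh, hlE, hlE0, hlρ, hlρ0, hℓ⟩ :=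
    exists_weak_limit hbot (hS.continuousOn μ) hτ hu hh hCu hCh
      (fun n => (dist_comm _ _).trans_le (hbd n).1) hE'
  have hN1 : ∀ k, 1 ≤ φ k + 1 := fun k => by omega
  have hN : Tendsto (fun k => φ k + 1) atTop atTop :=
    (tendsto_add_atTop_nat 1).comp hφ.tendsto_atTop
  have hδ : Tendsto (fun k => 1 / ((φ k : ℝ) + 1)) atTop (𝓝 0) :=
    tendsto_one_div_add_atTop_nhds_zero_nat.comp hφ.tendsto_atTop
  have hℓN : ∀ t, 0 < t →
      Tendsto (fun k => dist (x (φ k)) (S (gridCeil (φ k + 1) t) μ)) atTop (𝓝 (ℓ t)) :=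
    fun t ht => tendsto_dist_gridCeil (hS.continuousOn μ) ht (hℓ t ht).1 hN
  have hℓm : AEMeasurable ℓ (volume.restrict (Ioi 0)) := by
    refine aemeasurable_of_tendsto_metrizable_ae atTop
      (fun k => aemeasurable_dist_flow (μ := μ) (π := x (φ k)) hS) ?_
    filter_upwards [ae_restrict_mem measurableSet_Ioi] with t ht using (hℓ t ht).1
  have hΛ := tendsto_Lam_discrete (κ := κ) (S := S) (m := m) hε hN1 hN hℓN
  have hΛ0 := mul_pos hM (integral_exp_mul_lamProfile_pos (κ := κ) (m := m) hε hℓm)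
  have hFx : Tendsto (fun k => fDag κ S (discreteExpMeasure (m + 1) (φ k + 1)) a b c ε m ρ μ
      (x (φ k))) atTop (𝓝 (1 / 2 * a * lρ ^ 2 + b * (-(1 / (m : ℝ)) * Real.log
        (((m + 1 : ℕ) : ℝ) * ∫ t in Ioi (0 : ℝ), Real.exp (-((m + 1 : ℕ) : ℝ) * t) *
          lamProfile κ ε m t (ℓ t))) + c)) := by
    have h1 := (hlρ.pow 2).const_mul (1 / 2 * a)
    have h2 := ((hΛ.log hΛ0.ne').const_mul (-(1 / (m : ℝ)))).const_mul b
    exact (h1.add h2).add_const c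
  have hcomp := fun y => le_of_tendsto_of_tendsto'
    (tendsto_const_nhds.sub (hF hN1 hN y)) ((hlu.sub hFx).add hδ) fun k => hxopt (φ k) y
  simp only [add_zero] at hcomp
  obtain ⟨hu0, hρ0, hae⟩ :=
    limits_attained hS ha hb hε hm hlu0 hlρ0 hℓm (fun t ht => (hℓ t ht).2) (hcomp x₀)
  refine ⟨x₀, hx₀, fun y => (hcomp y).trans (le_of_eq ?_), ?_⟩
  · have hint : ∫ t in Ioi (0 : ℝ), Real.exp (-((m + 1 : ℕ) : ℝ) * t) *
          lamProfile κ ε m t (ℓ t) =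
        ∫ t in Ioi (0 : ℝ), Real.exp (-((m + 1 : ℕ) : ℝ) * t) *
          lamProfile κ ε m t (dist x₀ (S t μ)) := by
      refine integral_congr_ae ?_
      filter_upwards [hae] with t ht
      rw [ht]
    rw [hu0, hρ0, hint, fDag, Lam_exp]
  · rw [hρ0] at hlρ
    rw [hu0] at hlu
    have := realHam_limit (θ := θ) hS hbot hlsc hμ ha hb hε hm hlam hN1 hN
      ((hlu.sub hlh).sub hδ) hlE hlE0 hlρ hℓN hae fun k => by
        have := hxham (φ k)
        linarith
    linarith

/-! ### Extended real values -/

lemma gDag_eq (ν : Measure ℝ) {a b ε : ℝ} {m : ℕ} {ρ μ π : E} (hπ : 𝓔 π ≠ ⊤) :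
    gDag 𝓔 κ S ν a b ε m ρ μ π =
      ((realHam 𝓔 κ S ν a b (a ^ 2 / 2) ε m ρ μ π : ℝ) : EReal) := by
  rw [gDag, if_neg hπ, realHam]

lemma gDdag_eq (ν : Measure ℝ) {a b ε : ℝ} {m : ℕ} {γ π μ : E} (hμ : 𝓔 μ ≠ ⊤) :
    gDdag 𝓔 κ S ν a b ε m γ π μ =
      ((-realHam 𝓔 κ S ν a b (-(a ^ 2 / 2)) ε m γ π μ : ℝ) : EReal) := by
  rw [gDdag, if_neg hμ, realHam, dist_comm γ μ]
  congr 1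
  ring

lemma fDdag_eq (ν : Measure ℝ) {a b c ε : ℝ} {m : ℕ} {γ π μ : E} :
    fDdag κ S ν a b c ε m γ π μ = -fDag κ S ν a b (-c) ε m γ π μ := by
  rw [fDdag, fDag, dist_comm γ μ]
  ring

lemma le_fDag_discrete {a b c ε : ℝ} {m N : ℕ} {ρ μ π : E} (ha : 0 < a) (hb : 0 < b)
    (hε : 0 < ε) (hN : 1 ≤ N) :
    c ≤ fDag κ S (discreteExpMeasure (m + 1) N) a b c ε m ρ μ π := by
  have hlog := Real.log_nonpos
    (Lam_discrete_pos (κ := κ) (S := S) (ε := ε) (m := m) (μ := μ) (π := π) hN).le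
    (Lam_discrete_le_one hε hN)
  have hL : 0 ≤ b * (-(1 / (m : ℝ)) *
      Real.log (Lam κ S (discreteExpMeasure (m + 1) N) ε m μ π)) :=
    mul_nonneg hb.le (mul_nonneg_of_nonpos_of_nonpos (by simp) hlog)
  have hd : 0 ≤ 1 / 2 * a * dist π ρ ^ 2 := by positivity
  unfold fDag
  linarith

/-- From convergence to the supremum in `EReal` to real, almost optimal points. -/
lemma eventually_le_add_of_tendsto_iSup {X : Type*} {f : X → ℝ} {C : ℝ} (hC : ∀ y, f y ≤ C)
    {x : ℕ → X} (hx : Tendsto (fun n => (f (x n) : EReal)) atTop (𝓝 (⨆ y, (f y : EReal))))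
    {δ : ℝ} (hδ : 0 < δ) : ∀ᶠ n in atTop, ∀ y, f y ≤ f (x n) + δ := by
  have h1 : (⨆ y, (f y : EReal)) ≤ (C : EReal) :=
    iSup_le fun y => EReal.coe_le_coe_iff.2 (hC y)
  have h2 : ((f (x 0) : ℝ) : EReal) ≤ ⨆ y, (f y : EReal) := le_iSup (fun y => (f y : EReal)) _
  have h3 : ∀ y, (f y : EReal) ≤ ⨆ y, (f y : EReal) := le_iSup (fun y => (f y : EReal))
  generalize (⨆ y, (f y : EReal)) = s at *
  lift s to ℝ using ⟨(h1.trans_lt (EReal.coe_lt_top _)).ne, ((EReal.bot_lt_coe _).trans_le h2).ne'⟩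
  filter_upwards [(EReal.tendsto_coe.1 hx).eventually_const_lt (sub_lt_self s hδ)] with n hn y
  have := EReal.coe_le_coe_iff.1 (h3 y)
  linarith

end Optimal

/-! ### Sub- and supersolutions -/

section Solutions

variable {E : Type*} [MetricSpace E] {𝓔 : E → EReal} {κ : ℝ} {S : ℝ → E → E}

lemma isViscositySubsolution_H3Dag (hE : MetricEnergyAssumption 𝓔)
    (hS : IsEVIGradientFlow 𝓔 κ S) {τ : TopologicalSpace E} (hτ : WeakTopologyAssumption 𝓔 τ)
    {lam : ℝ} (hlam : 0 < lam) {h : E → ℝ} (hh : @Continuous E ℝ τ _ h) {Ch : ℝ}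
    (hCh : ∀ π, |h π| ≤ Ch) {u : E → ℝ} (hu : @UpperSemicontinuous E ℝ τ _ u)
    (hsol : IsViscositySubsolution lam h (H2Dag 𝓔 κ S) u) :
    IsViscositySubsolution lam h (H3Dag 𝓔 κ S) u := by
  obtain ⟨⟨C, hC⟩, husc, hsub⟩ := hsol
  refine ⟨⟨C, hC⟩, husc, ?_⟩
  rintro p ⟨ρ, μ, a, b, ε, c, m, hI, ha, hb, hε, hm, rfl⟩
  have hμ : 𝓔 μ ≠ ⊤ := energy_ne_top_of_information_lt (le_add_self.trans_lt hI)
  obtain ⟨x₀, hx₀, hmax, hineq⟩ := exists_optimal (c := c) (θ := a ^ 2 / 2) (ρ := ρ) hS hE.ne_bot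
    hE.lsc hμ ha hb hε hm hlam hτ hu hh hC hCh fun n hn δ hδ => by
      obtain ⟨x, hx1, hx2⟩ := hsub _ ⟨ρ, μ, a, b, ε, c, m, n, hI, ha, hb, hε, hm, hn, rfl⟩
      have hbound : ∀ y, u y - fDag κ S (discreteExpMeasure (m + 1) n) a b c ε m ρ μ y ≤
          C - c := fun y => by
        have := (abs_le.1 (hC y)).2
        have := le_fDag_discrete (κ := κ) (S := S) (c := c) (m := m) (ρ := ρ) (μ := μ) (π := y)
          ha hb hε hn
        linarith
      obtain ⟨k, hk1, hk2⟩ := ((eventually_le_add_of_tendsto_iSup hbound hx1 hδ).and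
        (eventually_lt_of_limsup_lt (hx2.trans_lt (EReal.coe_pos.2 hδ)))).exists
      have hxk : 𝓔 (x k) ≠ ⊤ := by
        intro htop
        simp only [gDag, if_pos htop] at hk2
        rw [EReal.coe_mul_bot_of_pos hlam, EReal.coe_sub_bot, EReal.top_sub_coe] at hk2
        exact not_top_lt hk2
      refine ⟨x k, hxk, hk1, ?_⟩
      simp only [gDag_eq _ hxk] at hk2
      norm_cast at hk2
      exact hk2.le
  refine ⟨fun _ => x₀, ?_, ?_⟩
  · refine tendsto_const_nhds_iff.2 (le_antisymm (le_iSup (fun π => ((u π - fDag κ S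
      (ProbabilityTheory.expMeasure ((m : ℝ) + 1)) a b c ε m ρ μ π : ℝ) : EReal)) x₀) ?_)
    exact iSup_le fun y => EReal.coe_le_coe_iff.2 (hmax y)
  · simp only [gDag_eq _ hx₀, limsup_const]
    exact_mod_cast hineq

/-- The supersolution `v` is treated through the function `-v`. -/
lemma isViscositySupersolution_H3Ddag (hE : MetricEnergyAssumption 𝓔)
    (hS : IsEVIGradientFlow 𝓔 κ S) {τ : TopologicalSpace E} (hτ : WeakTopologyAssumption 𝓔 τ)
    {lam : ℝ} (hlam : 0 < lam) {h : E → ℝ} (hh : @Continuous E ℝ τ _ h) {Ch : ℝ}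
    (hCh : ∀ π, |h π| ≤ Ch) {v : E → ℝ} (hv : @LowerSemicontinuous E ℝ τ _ v)
    (hsol : IsViscositySupersolution lam h (H2Ddag 𝓔 κ S) v) :
    IsViscositySupersolution lam h (H3Ddag 𝓔 κ S) v := by
  obtain ⟨⟨C, hC⟩, hvsc, hsup⟩ := hsol
  refine ⟨⟨C, hC⟩, hvsc, ?_⟩
  rintro p ⟨γ, π, a, b, ε, c, m, hI, ha, hb, hε, hm, rfl⟩
  have hπ : 𝓔 π ≠ ⊤ := energy_ne_top_of_information_lt (le_add_self.trans_lt hI)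
  have hu : @UpperSemicontinuous E ℝ τ _ fun π => -v π := fun x y hy => by
    filter_upwards [hv x (-y) (by linarith)] with z hz
    linarith
  obtain ⟨x₀, hx₀, hmax, hineq⟩ := exists_optimal (c := -c) (θ := -(a ^ 2 / 2)) (ρ := γ)
    (u := fun π => -v π) (h := fun π => -h π) (Cu := C) (Ch := Ch) hS hE.ne_bot
    hE.lsc hπ ha hb hε hm hlam hτ hu hh.neg (fun y => by rw [abs_neg]; exact hC y)
    (fun y => by rw [abs_neg]; exact hCh y) fun n hn δ hδ => by
      obtain ⟨x, hx1, hx2⟩ := hsup _ ⟨γ, π, a, b, ε, c, m, n, hI, ha, hb, hε, hm, hn, rfl⟩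
      have hbound : ∀ y, -v y - fDag κ S (discreteExpMeasure (m + 1) n) a b (-c) ε m γ π y ≤
          C + c := fun y => by
        have := (abs_le.1 (hC y)).1
        have := le_fDag_discrete (κ := κ) (S := S) (c := -c) (m := m) (ρ := γ) (μ := π) (π := y)
          ha hb hε hn
        linarith
      have hneg : ∀ y,
          ((-v y - fDag κ S (discreteExpMeasure (m + 1) n) a b (-c) ε m γ π y : ℝ) : EReal) =
          -((v y - fDdag κ S (discreteExpMeasure (m + 1) n) a b c ε m γ π y : ℝ) : EReal) :=
        fun y => by
          rw [← EReal.coe_neg, fDdag_eq]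
          congr 1
          ring
      have hx1' : Tendsto (fun k =>
          ((-v (x k) - fDag κ S (discreteExpMeasure (m + 1) n) a b (-c) ε m γ π (x k) : ℝ) :
            EReal)) atTop (𝓝 (⨆ y,
          ((-v y - fDag κ S (discreteExpMeasure (m + 1) n) a b (-c) ε m γ π y : ℝ) :
            EReal))) := by
        simp only [hneg]
        have h1 := (continuous_neg.tendsto _).comp hx1
        exact h1.trans_eq (congrArg 𝓝 (EReal.negOrderIso.map_iInf _))
      obtain ⟨k, hk1, hk2⟩ := ((eventually_le_add_of_tendsto_iSup hbound hx1' hδ).and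
        (eventually_lt_of_lt_liminf ((EReal.coe_lt_coe_iff.2 (neg_lt_zero.2 hδ)).trans_le
          hx2))).exists
      have hxk : 𝓔 (x k) ≠ ⊤ := by
        intro htop
        simp only [gDdag, if_pos htop] at hk2
        rw [EReal.coe_mul_top_of_pos hlam, EReal.sub_top, EReal.bot_sub] at hk2
        exact not_lt_bot hk2
      refine ⟨x k, hxk, hk1, ?_⟩
      simp only [gDdag_eq _ hxk] at hk2
      norm_cast at hk2
      linarith
  refine ⟨fun _ => x₀, ?_, ?_⟩
  · refine tendsto_const_nhds_iff.2 (le_antisymm ?_ (iInf_le (fun y => ((v y - fDdag κ S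
      (ProbabilityTheory.expMeasure ((m : ℝ) + 1)) a b c ε m γ π y : ℝ) : EReal)) x₀))
    refine le_iInf fun y => EReal.coe_le_coe_iff.2 ?_
    have := hmax y
    simp only [fDdag_eq]
    linarith
  · simp only [gDdag_eq _ hx₀, liminf_const]
    rw [← EReal.coe_mul, ← EReal.coe_sub, ← EReal.coe_sub, EReal.coe_nonneg]
    linarith

lemma exists_abs_le (h : E →ᵇ ℝ) : ∃ C, ∀ π, |h π| ≤ C := ⟨‖h‖, fun π => h.norm_coe_le_norm π⟩

end Solutions

end TataruHJ

theorem theorem5p5 {E : Type*} [MetricSpace E] (𝓔 : E → EReal)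
    (h : E →ᵇ ℝ) (hE : TataruHJ.MetricEnergyAssumption 𝓔)
    (τ : TopologicalSpace E) (hτ : TataruHJ.WeakTopologyAssumption 𝓔 τ)
    (κ : ℝ) (S : ℝ → E → E) (hS : TataruHJ.IsEVIGradientFlow 𝓔 κ S)
    (lam : ℝ) (hlam : 0 < lam) (hh : @Continuous E ℝ τ _ h) :
    (∀ u : E → ℝ, @UpperSemicontinuous E ℝ τ _ u →
      TataruHJ.IsViscositySubsolution lam h (TataruHJ.H2Dag 𝓔 κ S) u →
      TataruHJ.IsViscositySubsolution lam h (TataruHJ.H3Dag 𝓔 κ S) u) ∧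
    (∀ v : E → ℝ, @LowerSemicontinuous E ℝ τ _ v →
      TataruHJ.IsViscositySupersolution lam h (TataruHJ.H2Ddag 𝓔 κ S) v →
      TataruHJ.IsViscositySupersolution lam h (TataruHJ.H3Ddag 𝓔 κ S) v) := by
  obtain ⟨Ch, hCh⟩ := TataruHJ.exists_abs_le h
  exact ⟨fun _ hu hsol => TataruHJ.isViscositySubsolution_H3Dag hE hS hτ hlam hh hCh hu hsol,
    fun _ hv hsol => TataruHJ.isViscositySupersolution_H3Ddag hE hS hτ hlam hh hCh hv hsol⟩
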